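/- **Setting.** Let $\Sigma$ be one of the three simply connected complete surfaces of constant curvature $K\in\{0,1,-1\}$, realized in $\mathbb R^3$ with the form $\langle Qx,x\rangle$, $Q=\operatorname{diag}(1,1,K)$, which induces its metric: the Euclidean plane $\{x_3=1\}$, the unit sphere $\{x_1^2+x_2^2+x_3^2=1\}$, or the hyperbolic plane $\{x_1^2+x_2^2-x_3^2=-1,\ x_3>0\}$. Geodesics are the intersections of $\Sigma$ with two-dimensional vector subspaces of $\mathbb R^3$, and conics are the intersections of $\Sigma$ with quadrics $\{\langle Mx,x\rangle=0\}$, where $M\neq0$ is a real symmetric $3\times3$ matrix. Let $\gamma\subset\Sigma$ be a germ at a point $O$ of a regular oriented $C^2$-smooth curve with non-zero geodesic curvature. For distinct $A,B\in\gamma$ close to $O$, let $C_{AB}$ be the point of intersection, close to $O$, of the geodesics tangent to $\gamma$ at $A$ and at $B$, let $\lambda(A,B)$ be the length of the arc $AB$ of $\gamma$, and let $$L(A,B)=|AC_{AB}|+|BC_{AB}|-\lambda(A,B),$$ where $|XY|$ is the distance in $\Sigma$. The germ $\gamma$ has the *string Poritsky property* if it admits a regular $C^1$-smooth parametrization by a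 parameter $t$ such that, on a small enough arc of $\gamma$ around $O$, for every small enough $p>0$ there is a constant $c_p>0$ with $t(A)-t(B)=c_p$ for all pairs of points $B,A$ of the arc, ordered by the orientation ($B$ before $A$), with $L(A,B)=p$. **Theorem 1.6.** If $\gamma$ is as above and has the string Poritsky property, then $\gamma$ is a germ of a conic: there is a real symmetric $3\times 3$ matrix $M\ne0$ such that $\gamma$ coincides with $\Sigma\cap\{\langle Mx,x\rangle=0\}$ in a neighborhood of $O$. -/

import Mathlib

open Set Filter Topology

noncomputable section

/-- The three simply connected complete surfaces of constant curvature `0`, `1`, `-1`. -/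
inductive SpaceForm where
  | euclidean
  | sphere
  | hyperbolic

namespace SpaceForm

/-- The (Gaussian) curvature of the surface. -/
def curvature : SpaceForm → ℝ
  | euclidean => 0
  | sphere => 1
  | hyperbolic => -1

/-- The bilinear form `⟨Qx, y⟩` on `ℝ³`, where `Q = diag(1, 1, K)` and `K` is the curvature.
Its restriction to the tangent planes of the surface is the Riemannian metric. -/
def form (S : SpaceForm) (x y : Fin 3 → ℝ) : ℝ :=
  x 0 * y 0 + x 1 * y 1 + S.curvature * (x 2 * y 2)

/-- The standard model of the surface in `ℝ³`: the plane `x₃ = 1`, the unit sphere, or the upper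
sheet of the hyperboloid `x₁² + x₂² - x₃² = -1`. -/
def surface : SpaceForm → Set (Fin 3 → ℝ)
  | euclidean => {x | x 2 = 1}
  | sphere => {x | x 0 ^ 2 + x 1 ^ 2 + x 2 ^ 2 = 1}
  | hyperbolic => {x | x 0 ^ 2 + x 1 ^ 2 - x 2 ^ 2 = -1 ∧ 0 < x 2}

/-- The Riemannian distance between two points of the surface, that is, the length of the shortest
geodesic segment connecting them, in the standard models. -/
def segmentLength : (S : SpaceForm) → (x y : Fin 3 → ℝ) → ℝ
  | euclidean, x, y => Real.sqrt (form euclidean (x - y) (x - y))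
  | sphere, x, y => Real.arccos (form sphere x y)
  | hyperbolic, x, y => Real.arcosh (-form hyperbolic x y)

/-- The Riemannian length of a tangent vector. -/
def speed (S : SpaceForm) (v : Fin 3 → ℝ) : ℝ := Real.sqrt (S.form v v)

/-- The length of the arc of the parametrized curve `c` between the parameters `b` and `a`
(for `b ≤ a`). -/
def arcLength (S : SpaceForm) (c : ℝ → Fin 3 → ℝ) (b a : ℝ) : ℝ :=
  ∫ s in b..a, S.speed (deriv c s)

/-- The geodesic tangent to the curve `c` at the point `c a`: the intersection of the surface with
the plane through the origin spanned by `c a` and the velocity at `a`. -/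
def tangentGeodesic (S : SpaceForm) (c : ℝ → Fin 3 → ℝ) (a : ℝ) : Set (Fin 3 → ℝ) :=
  S.surface ∩ (Submodule.span ℝ {c a, deriv c a} : Set (Fin 3 → ℝ))

/-- The covariant derivative `∇_{c'} c'` of the velocity of a curve `c` on the surface: the
component of `c''` tangent to the surface. For `K = ±1` the `Q`-normal line at `x` is spanned by `x`
and `⟨Qx, x⟩ = K`; for `K = 0` the vector `c''` itself is tangent. -/
def covariantAcceleration (S : SpaceForm) (c : ℝ → Fin 3 → ℝ) (s : ℝ) : Fin 3 → ℝ :=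
  deriv (deriv c) s - (S.curvature * S.form (deriv (deriv c) s) (c s)) • c s

/-- The (absolute) geodesic curvature `|c' ∧ ∇_{c'} c'| / |c'| ^ 3` of a regular curve on the
surface. When `c` is parametrized by length this is the length of `∇_{c'} c'`. -/
def geodesicCurvature (S : SpaceForm) (c : ℝ → Fin 3 → ℝ) (s : ℝ) : ℝ :=
  Real.sqrt
      (S.form (deriv c s) (deriv c s) *
          S.form (S.covariantAcceleration c s) (S.covariantAcceleration c s) -
        S.form (deriv c s) (S.covariantAcceleration c s) ^ 2) /
    S.speed (deriv c s) ^ 3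

/-- `c` represents, near the parameter value `0`, a germ at the point `c 0` of a (regular, oriented)
`C²`-smooth curve on the surface. -/
structure IsC2CurveGerm (S : SpaceForm) (c : ℝ → Fin 3 → ℝ) : Prop where
  mem_surface : ∀ᶠ s in 𝓝 (0 : ℝ), c s ∈ S.surface
  contDiffAt : ContDiffAt ℝ 2 c 0
  regular : deriv c 0 ≠ 0

/-- The quantity `L(A, B) = |AC| + |BC| - λ(A, B)`, where `A = c a`, `B = c b`, `b ≤ a`, the
function `λ` is the length of the arc of `c` between `A` and `B`, and `C` is the point of
intersection of the geodesics tangent to `c` at `A` and `B`. -/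
def stringL (S : SpaceForm) (c : ℝ → Fin 3 → ℝ) (a b : ℝ) (C : Fin 3 → ℝ) : ℝ :=
  S.segmentLength (c a) C + S.segmentLength (c b) C - S.arcLength c b a

/-- The string Poritsky property of the germ at `c 0` of the curve `c`, oriented by its
parametrization. The curve admits a regular `C¹` parameter `t` such that, on a small enough arc, for
every small enough `p > 0` there is a constant `q > 0` with `t(A) - t(B) = q` for all pairs of points
`B`, `A` ordered by the orientation with `L(A, B) = p`. The condition `C ∈ U` with `U` a
neighborhood of the base point selects the intersection point of the two tangent geodesics which is
close to `A` and `B`: on the sphere the geodesics also meet at the antipode. -/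
def HasStringPoritskyProperty (S : SpaceForm) (c : ℝ → Fin 3 → ℝ) : Prop :=
  ∃ t : ℝ → ℝ, ContDiffAt ℝ 1 t 0 ∧ deriv t 0 ≠ 0 ∧
    ∃ ε > 0, ∃ U ∈ 𝓝 (c 0), ∃ p₀ > 0, ∀ p : ℝ, 0 < p → p < p₀ →
      ∃ q : ℝ, 0 < q ∧ ∀ a ∈ Ioo (-ε) ε, ∀ b ∈ Ioo (-ε) ε, b < a →
        ∀ C ∈ U, C ∈ S.tangentGeodesic c a → C ∈ S.tangentGeodesic c b →
          S.stringL c a b C = p → t a - t b = q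

/-- The intersection of the surface with the quadric `⟨Mx, x⟩ = 0`. -/
def conic (S : SpaceForm) (M : Matrix (Fin 3) (Fin 3) ℝ) : Set (Fin 3 → ℝ) :=
  S.surface ∩ {x | (M.mulVec x) ⬝ᵥ x = 0}

/-- The germ of the curve `c` at `c 0` is the germ of a conic: for every small enough arc of `c`
around `c 0`, the arc and the conic coincide, as sets, in a neighborhood of `c 0`. -/
def IsConicGerm (S : SpaceForm) (c : ℝ → Fin 3 → ℝ) : Prop :=
  ∃ M : Matrix (Fin 3) (Fin 3) ℝ, M.IsSymm ∧ M ≠ 0 ∧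
    ∀ᶠ ε in 𝓝[>] (0 : ℝ), c '' Ioo (-ε) ε =ᶠ[𝓝 (c 0)] S.conic M

end SpaceForm

end

/-!
Write `N = c × c'` for the normal of the plane that cuts out the tangent geodesic, `D = det (c, c',
c'')` for the Wronskian (non-zero because the geodesic curvature is), and `v` for the speed.

*The differential of the string length.* Let `C` be the intersection point of the tangent geodesics
at `c a` and `c b`. When `a` moves, `C` moves along the geodesic tangent at `c b`; the first
variation formula (`hasDerivAt_segmentLength`) then gives the partial derivatives of `L(a, b)` as
`D(a) v(b) ⟨N(b), c(a)⟩` and `-D(b) v(a) ⟨N(a), c(b)⟩`, up to a common non-zero factor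
(`IsCurvedArc.hasStrictFDerivAt_stringL`). The factor contains `1 + cos φ`, where `φ` is the angle
at `C`. Moreover `L` is positive and tends to `0` on the diagonal, so the Poritsky property applies to
all pairs of points of a short arc.

*The symmetric pairing.* By the Poritsky property, `t(a) - t(b)` is constant on the level sets of `L`,
so by Lagrange multipliers the differentials of these two functions are proportional. With the
formulas above this says that for `n = (v t' / D) N` the pairing `⟨n(a), c(b)⟩` is symmetric in `a`
and `b` (`IsCurvedArc.weight_symm`).

*The conic.* The points of the curve span `ℝ³`, so a symmetric pairing `⟨n(a), c(b)⟩` has the form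
`n(a) = M c(a)` with a constant symmetric matrix `M` (`exists_isSymm_mulVec_eq`). Therefore
`⟨M c, c⟩ = ⟨n, c⟩ = 0`. The quadric is transversal to the surface at `c 0`, because `M c(0)` is
proportional to `N(0)`; so the conic contains no other points near `c 0` (`eventually_mem_image`).

The three geometries are treated alike by using, along with the metric `form`, the dual form `polar`.
-/

noncomputable section

namespace SpaceForm

open Matrix

/-! ### The surfaces, the metric and the distance -/

/-- The bilinear form `diag(K, K, 1)`, dual to `form` up to the factor `K`. The points of the surface
satisfy `polar x x = 1`, the tangent plane at `x` is the `polar`-orthogonal complement of `x`, and on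
the surface `polar x y` is `1`, `cos |xy|` or `cosh |xy|`: it treats the three geometries alike,
including the flat one, where `form x x = 1` does not describe the surface. -/
def polar (S : SpaceForm) (x y : Fin 3 → ℝ) : ℝ :=
  S.curvature * (x 0 * y 0 + x 1 * y 1) + x 2 * y 2

section Bilinear

variable (S : SpaceForm) (x y z : Fin 3 → ℝ) (r : ℝ)

lemma form_comm : S.form x y = S.form y x := by simp only [form]; ring
lemma form_add_left : S.form (x + y) z = S.form x z + S.form y z := by
  simp only [form, Pi.add_apply]; ring
lemma form_sub_left : S.form (x - y) z = S.form x z - S.form y z := by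
  simp only [form, Pi.sub_apply]; ring
lemma form_smul_left : S.form (r • x) z = r * S.form x z := by
  simp only [form, Pi.smul_apply, smul_eq_mul]; ring
lemma form_add_right : S.form z (x + y) = S.form z x + S.form z y := by
  simp only [form, Pi.add_apply]; ring
lemma form_sub_right : S.form z (x - y) = S.form z x - S.form z y := by
  simp only [form, Pi.sub_apply]; ring
lemma form_smul_right : S.form z (r • x) = r * S.form z x := by
  simp only [form, Pi.smul_apply, smul_eq_mul]; ring

lemma polar_comm : S.polar x y = S.polar y x := by simp only [polar]; ring
lemma polar_add_right : S.polar z (x + y) = S.polar z x + S.polar z y := by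
  simp only [polar, Pi.add_apply]; ring
lemma polar_sub_right : S.polar z (x - y) = S.polar z x - S.polar z y := by
  simp only [polar, Pi.sub_apply]; ring
lemma polar_smul_right : S.polar z (r • x) = r * S.polar z x := by
  simp only [polar, Pi.smul_apply, smul_eq_mul]; ring
lemma polar_add_left : S.polar (x + y) z = S.polar x z + S.polar y z := by
  simp only [polar, Pi.add_apply]; ring
lemma polar_smul_left : S.polar (r • x) z = r * S.polar x z := by
  simp only [polar, Pi.smul_apply, smul_eq_mul]; ring

end Bilinear

section Algebra

/-- Cramer's rule in `ℝ³`. -/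
lemma triple_smul_eq (u v w z : Fin 3 → ℝ) :
    (u ⬝ᵥ v ⨯₃ w) • z =
      (z ⬝ᵥ v ⨯₃ w) • u + (u ⬝ᵥ z ⨯₃ w) • v + (u ⬝ᵥ v ⨯₃ z) • w := by
  ext i
  fin_cases i <;>
    simp [cross_apply, dotProduct, Fin.sum_univ_three] <;> ring

lemma eq_zero_of_dotProduct_eq_zero {u v w z : Fin 3 → ℝ} (h : u ⬝ᵥ v ⨯₃ w ≠ 0)
    (hu : u ⬝ᵥ z = 0) (hv : v ⬝ᵥ z = 0) (hw : w ⬝ᵥ z = 0) : z = 0 := by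
  have key : (u ⬝ᵥ v ⨯₃ w) • z =
      (u ⬝ᵥ z) • (v ⨯₃ w) + (v ⬝ᵥ z) • (w ⨯₃ u) + (w ⬝ᵥ z) • (u ⨯₃ v) := by
    ext i
    fin_cases i <;>
      simp [cross_apply, dotProduct, Fin.sum_univ_three] <;> ring
  rw [hu, hv, hw] at key
  simpa [h] using key

lemma cross_cross_right (n u v : Fin 3 → ℝ) :
    n ⨯₃ (u ⨯₃ v) = (n ⬝ᵥ v) • u - (n ⬝ᵥ u) • v := by
  ext i
  fin_cases i <;>
    simp [cross_apply, dotProduct, Fin.sum_univ_three] <;> ring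

lemma cross_cross_left (u v n : Fin 3 → ℝ) :
    (u ⨯₃ v) ⨯₃ n = (n ⬝ᵥ u) • v - (n ⬝ᵥ v) • u := by
  ext i
  fin_cases i <;>
    simp [cross_apply, dotProduct, Fin.sum_univ_three] <;> ring

end Algebra

section Surface

variable {S : SpaceForm} {x y z : Fin 3 → ℝ}

/-- The open cone of the vectors that can be rescaled by a positive factor to a point of the
surface. -/
def cone (S : SpaceForm) : Set (Fin 3 → ℝ) :=
  {x | 0 < S.polar x x ∧ (S ≠ sphere → 0 < x 2)}

/-- The radial projection of the cone over the surface to the surface. -/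
def normalize (S : SpaceForm) (x : Fin 3 → ℝ) : Fin 3 → ℝ := (√(S.polar x x))⁻¹ • x

lemma mem_surface_iff : x ∈ S.surface ↔ S.polar x x = 1 ∧ (S ≠ sphere → 0 < x 2) := by
  cases S
  · simp only [surface, polar, curvature, mem_ofPred_eq, ne_eq, reduceCtorEq, not_false_eq_true,
      forall_const]
    constructor
    · intro h; rw [h]; norm_num
    · rintro ⟨h, h2⟩; nlinarith
  · simp only [surface, polar, curvature, mem_ofPred_eq, ne_eq, not_true_eq_false,
      IsEmpty.forall_iff, and_true]
    constructor <;> intro h <;> linarith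
  · simp only [surface, polar, curvature, mem_ofPred_eq, ne_eq, reduceCtorEq, not_false_eq_true,
      forall_const]
    constructor <;> rintro ⟨h, h2⟩ <;> exact ⟨by linarith, h2⟩

lemma polar_self (hx : x ∈ S.surface) : S.polar x x = 1 := (mem_surface_iff.1 hx).1

lemma surface_subset_cone : S.surface ⊆ S.cone := fun x hx => by
  rw [mem_surface_iff] at hx
  exact ⟨by rw [hx.1]; norm_num, hx.2⟩

lemma continuous_polar_self : Continuous fun x => S.polar x x := by
  unfold polar; fun_prop

lemma contDiff_polar_self : ContDiff ℝ 1 fun x => S.polar x x := by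
  unfold polar; fun_prop

lemma isOpen_cone : IsOpen S.cone := by
  by_cases hS : S = sphere
  · simp only [cone, hS, ne_eq, not_true_eq_false, IsEmpty.forall_iff, and_true]
    exact isOpen_lt continuous_const continuous_polar_self
  · simp only [cone, hS, ne_eq, not_false_eq_true, forall_const]
    exact (isOpen_lt continuous_const continuous_polar_self).inter
      (isOpen_lt continuous_const (continuous_apply 2))

lemma smul_mem_cone {r : ℝ} (hr : 0 < r) : r • x ∈ S.cone ↔ x ∈ S.cone := by
  simp only [cone, mem_ofPred_eq, polar_smul_left, polar_smul_right, Pi.smul_apply, smul_eq_mul,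
    mul_pos_iff_of_pos_left hr]

lemma normalize_smul {r : ℝ} (hr : 0 < r) : S.normalize (r • x) = S.normalize x := by
  have : √(S.polar (r • x) (r • x)) = r * √(S.polar x x) := by
    rw [polar_smul_left, polar_smul_right, ← mul_assoc, Real.sqrt_mul (by positivity),
      Real.sqrt_mul_self hr.le]
  rw [normalize, this, mul_inv, smul_smul, normalize]
  congr 1
  field_simp

lemma normalize_mem (hx : x ∈ S.cone) : S.normalize x ∈ S.surface := by
  have h := Real.sqrt_pos.2 hx.1
  rw [mem_surface_iff]
  refine ⟨?_, fun hS => ?_⟩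
  · rw [normalize, polar_smul_left, polar_smul_right]
    field_simp
    rw [Real.sq_sqrt hx.1.le]
  · simp only [normalize, Pi.smul_apply, smul_eq_mul]
    exact mul_pos (inv_pos.2 h) (hx.2 hS)

lemma normalize_eq_self (hx : x ∈ S.surface) : S.normalize x = x := by
  simp [normalize, polar_self hx]

lemma contDiffAt_normalize (hx : x ∈ S.cone) : ContDiffAt ℝ 1 S.normalize x := by
  unfold normalize
  have h := (Real.sqrt_pos.2 hx.1).ne'
  exact ((contDiff_polar_self.contDiffAt.sqrt hx.1.ne').inv h).smul contDiffAt_id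

/-- On tangent vectors, `polar` is `K` times the metric. -/
lemma polar_eq_of_tangent {w : Fin 3 → ℝ} (hx : x ∈ S.surface) (hz : S.polar x z = 0) :
    S.polar z w = S.curvature * S.form z w := by
  cases S
  · simp only [surface, mem_ofPred_eq] at hx
    simp only [polar, curvature, hx] at hz
    simp only [polar, form, curvature]
    have : z 2 = 0 := by linarith
    rw [this]; ring
  · simp only [polar, form, curvature]; ring
  · simp only [polar, form, curvature]; ring

/-- The metric is positive definite on the tangent planes. -/
lemma form_tangent_pos (hx : x ∈ S.surface) (hz : S.polar x z = 0) (h0 : z ≠ 0) :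
    0 < S.form z z := by
  have hne : z 0 ^ 2 + z 1 ^ 2 + z 2 ^ 2 ≠ 0 := by
    intro h
    apply h0
    ext i
    fin_cases i <;> simp <;> nlinarith [sq_nonneg (z 0), sq_nonneg (z 1), sq_nonneg (z 2)]
  have hpos : 0 < z 0 ^ 2 + z 1 ^ 2 + z 2 ^ 2 := lt_of_le_of_ne (by positivity) hne.symm
  cases S
  · simp only [surface, mem_ofPred_eq] at hx
    simp only [polar, curvature, hx] at hz
    have : z 2 = 0 := by linarith
    rw [this] at hpos
    simp only [form, curvature]; nlinarith
  · simp only [form, curvature]; nlinarith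
  · simp only [surface, mem_ofPred_eq] at hx
    obtain ⟨hx, hx2⟩ := hx
    simp only [polar, curvature] at hz
    have hz' : x 2 * z 2 = x 0 * z 0 + x 1 * z 1 := by linarith
    simp only [form, curvature]
    have key : x 2 ^ 2 * (z 0 * z 0 + z 1 * z 1 + -1 * (z 2 * z 2)) =
        z 0 ^ 2 + z 1 ^ 2 + (x 0 * z 1 - x 1 * z 0) ^ 2 := by
      have h1 : x 2 ^ 2 = 1 + x 0 ^ 2 + x 1 ^ 2 := by linarith
      have h2 : x 2 ^ 2 * (z 2 * z 2) = (x 0 * z 0 + x 1 * z 1) ^ 2 := by rw [← hz']; ring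
      linear_combination (z 0 * z 0 + z 1 * z 1) * h1 - h2
    have h3 : 0 < z 0 ^ 2 + z 1 ^ 2 := by
      by_contra hcon
      have h00 : z 0 = 0 := by nlinarith [sq_nonneg (z 0), sq_nonneg (z 1)]
      have h11 : z 1 = 0 := by nlinarith [sq_nonneg (z 0), sq_nonneg (z 1)]
      rw [h00, h11] at hz'
      have : z 2 = 0 := by
        have : x 2 * z 2 = 0 := by linarith
        rcases mul_eq_zero.1 this with h | h
        · exact absurd h hx2.ne'
        · exact h
      rw [h00, h11, this] at hpos
      norm_num at hpos
    have h4 : 0 < x 2 ^ 2 := by positivity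
    refine pos_of_mul_pos_right (a := x 2 ^ 2) ?_ h4.le
    rw [key]; positivity

end Surface

section Distance

variable {S : SpaceForm} {x y : Fin 3 → ℝ} {r : ℝ}

/-- The Pythagorean identity `cos² + sin² = 1` with its analogues for `K = 0, -1`. -/
lemma polar_sq_add (hx : x ∈ S.surface) (hy : y ∈ S.surface)
    (h : S.form (y - S.polar x y • x) (y - S.polar x y • x) = r ^ 2) :
    S.polar x y ^ 2 + S.curvature * r ^ 2 = 1 := by
  have hz : S.polar x (y - S.polar x y • x) = 0 := by
    rw [polar_sub_right, polar_smul_right, polar_self hx]; ring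
  have h1 := polar_eq_of_tangent (w := y - S.polar x y • x) hx hz
  rw [h, polar_sub_right, polar_smul_right, S.polar_comm _ x, hz, S.polar_comm _ y,
    polar_sub_right, polar_self hy, polar_smul_right, S.polar_comm y x] at h1
  linarith

lemma one_lt_neg_form (hx : x ∈ hyperbolic.surface) (hy : y ∈ hyperbolic.surface) (hr : 0 < r)
    (h : hyperbolic.form (y - hyperbolic.polar x y • x) (y - hyperbolic.polar x y • x) = r ^ 2) :
    1 < -hyperbolic.form x y := by
  have h1 := polar_sq_add hx hy h
  have h2 : hyperbolic.polar x y = -hyperbolic.form x y := by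
    simp only [polar, form, curvature]; ring
  have h3 : 0 < -hyperbolic.form x y := by
    obtain ⟨hx, hx2⟩ := hx
    obtain ⟨hy, hy2⟩ := hy
    simp only [form, curvature]
    have h4 : (x 0 * y 0 + x 1 * y 1) ^ 2 < (x 2 * y 2) ^ 2 := by
      have e1 : x 2 ^ 2 = 1 + x 0 ^ 2 + x 1 ^ 2 := by linarith
      have e2 : y 2 ^ 2 = 1 + y 0 ^ 2 + y 1 ^ 2 := by linarith
      rw [mul_pow, e1, e2]
      nlinarith [sq_nonneg (x 0 * y 1 - x 1 * y 0), sq_nonneg (x 0), sq_nonneg (x 1),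
        sq_nonneg (y 0), sq_nonneg (y 1)]
    have := lt_of_pow_lt_pow_left₀ 2 (by positivity) h4
    linarith
  rw [h2] at h1
  simp only [curvature] at h1
  nlinarith [sq_pos_of_pos hr]

lemma form_ne_one_of_sphere (hx : x ∈ sphere.surface) (hy : y ∈ sphere.surface) (hr : 0 < r)
    (h : sphere.form (y - sphere.polar x y • x) (y - sphere.polar x y • x) = r ^ 2) :
    1 - sphere.form x y ^ 2 = r ^ 2 ∧ sphere.form x y ≠ -1 ∧ sphere.form x y ≠ 1 := by
  have h1 := polar_sq_add hx hy h
  have h2 : sphere.polar x y = sphere.form x y := by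
    simp only [polar, form, curvature]; ring
  rw [h2] at h1
  simp only [curvature] at h1
  refine ⟨by linarith, ?_, ?_⟩ <;> intro h3 <;> rw [h3] at h1 <;> nlinarith [sq_pos_of_pos hr]

lemma form_sub_euclidean (hx : x ∈ euclidean.surface) (hy : y ∈ euclidean.surface)
    (h : euclidean.form (y - euclidean.polar x y • x) (y - euclidean.polar x y • x) = r ^ 2) :
    euclidean.form (x - y) (x - y) = r ^ 2 := by
  simp only [surface, mem_ofPred_eq] at hx hy
  rw [← h]
  simp [form, polar, curvature, hx, hy]; ring

lemma contDiffAt_segmentLength (hx : x ∈ S.surface) (hy : y ∈ S.surface) (hr : 0 < r)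
    (h : S.form (y - S.polar x y • x) (y - S.polar x y • x) = r ^ 2) :
    ContDiffAt ℝ 1 (fun p : (Fin 3 → ℝ) × (Fin 3 → ℝ) => S.segmentLength p.1 p.2) (x, y) := by
  cases S
  · have := form_sub_euclidean hx hy h
    simp only [segmentLength]
    refine ContDiffAt.sqrt ?_ ?_
    · simp only [form, Pi.sub_apply]; fun_prop
    · simp only [this]; positivity
  · obtain ⟨-, h1, h2⟩ := form_ne_one_of_sphere hx hy hr h
    simp only [segmentLength]
    have hf : ContDiffAt ℝ 1
        (fun p : (Fin 3 → ℝ) × (Fin 3 → ℝ) => sphere.form p.1 p.2) (x, y) := by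
      simp only [form]; fun_prop
    exact ContDiffAt.comp (g := Real.arccos) (x, y) (Real.contDiffAt_arccos h1 h2) hf
  · have h1 := one_lt_neg_form hx hy hr h
    simp only [segmentLength]
    have hf : ContDiffAt ℝ 1
        (fun p : (Fin 3 → ℝ) × (Fin 3 → ℝ) => -hyperbolic.form p.1 p.2) (x, y) := by
      simp only [form]; fun_prop
    exact ContDiffAt.comp (g := Real.arcosh) (x, y)
      (Real.contDiffAt_arcosh (x := -hyperbolic.form x y) h1) hf

lemma continuousAt_segmentLength_self (hx : x ∈ S.surface) :
    ContinuousAt (fun p : (Fin 3 → ℝ) × (Fin 3 → ℝ) => S.segmentLength p.1 p.2) (x, x) := by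
  cases S
  · simp only [segmentLength, form, Pi.sub_apply]; fun_prop
  · simp only [segmentLength, form]
    exact (Real.continuous_arccos.comp (by fun_prop)).continuousAt
  · have h1 : -hyperbolic.form x x = 1 := by
      rw [← polar_self hx]; simp only [polar, form, curvature]; ring
    simp only [segmentLength, Real.arcosh]
    refine ContinuousAt.log ?_ ?_
    · simp only [form]; fun_prop
    · rw [h1]; norm_num

lemma segmentLength_self (hx : x ∈ S.surface) : S.segmentLength x x = 0 := by
  have h1 := polar_self hx
  cases S
  · simp [segmentLength, form]
  · have h2 : sphere.form x x = 1 := by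
      rw [← h1]; simp only [polar, form, curvature]; ring
    simp [segmentLength, h2]
  · have h2 : -hyperbolic.form x x = 1 := by
      rw [← h1]; simp only [polar, form, curvature]; ring
    simp [segmentLength, h2]

lemma hasDerivAt_form {f g : ℝ → Fin 3 → ℝ} {f' g' : Fin 3 → ℝ} {s : ℝ}
    (hf : HasDerivAt f f' s) (hg : HasDerivAt g g' s) :
    HasDerivAt (fun u => S.form (f u) (g u)) (S.form f' (g s) + S.form (f s) g') s := by
  rw [hasDerivAt_pi] at hf hg
  simp only [form]
  refine ((((hf 0).mul (hg 0)).add ((hf 1).mul (hg 1))).add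
    (((hf 2).mul (hg 2)).const_mul S.curvature)).congr_deriv ?_
  ring

lemma hasDerivAt_polar {f g : ℝ → Fin 3 → ℝ} {f' g' : Fin 3 → ℝ} {s : ℝ}
    (hf : HasDerivAt f f' s) (hg : HasDerivAt g g' s) :
    HasDerivAt (fun u => S.polar (f u) (g u)) (S.polar f' (g s) + S.polar (f s) g') s := by
  rw [hasDerivAt_pi] at hf hg
  simp only [polar]
  refine (((((hf 0).mul (hg 0)).add ((hf 1).mul (hg 1))).const_mul S.curvature).add
    ((hf 2).mul (hg 2))).congr_deriv ?_
  ring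

/-- The first variation formula for the distance between two points moving along the surface. With
`co = polar (f s) (g s)`,
`(f s - co • g s) / r` and `(g s - co • f s) / r` are the unit vectors at the end points pointing
along the segment, so that `r` is the sine, length, or hyperbolic sine of the distance. -/
lemma hasDerivAt_segmentLength {f g : ℝ → Fin 3 → ℝ} {f' g' : Fin 3 → ℝ} {s : ℝ}
    (hf : HasDerivAt f f' s) (hg : HasDerivAt g g' s)
    (hfS : f s ∈ S.surface) (hgS : g s ∈ S.surface)
    (hf' : S.polar (f s) f' = 0) (hg' : S.polar (g s) g' = 0) (hr : 0 < r)
    (h : S.form (g s - S.polar (f s) (g s) • f s) (g s - S.polar (f s) (g s) • f s) = r ^ 2) :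
    HasDerivAt (fun u => S.segmentLength (f u) (g u))
      (-(S.form f' (g s - S.polar (f s) (g s) • f s) +
        S.form g' (f s - S.polar (f s) (g s) • g s)) / r) s := by
  cases S
  · have h1 := form_sub_euclidean hfS hgS h
    simp only [segmentLength]
    have h2 := (hasDerivAt_form (S := euclidean) (hf.sub hg) (hf.sub hg)).sqrt
      (by simp only [Pi.sub_apply] at h1 ⊢; rw [h1]; positivity)
    refine h2.congr_deriv ?_
    simp only [Pi.sub_apply]
    rw [h1, Real.sqrt_sq hr.le]
    have hco : euclidean.polar (f s) (g s) = 1 := by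
      simp only [surface, mem_ofPred_eq] at hfS hgS
      simp [polar, curvature, hfS, hgS]
    rw [hco, div_eq_div_iff (by positivity) hr.ne']
    simp only [form, Pi.sub_apply, Pi.smul_apply, smul_eq_mul]
    ring
  · obtain ⟨h1, h2, h3⟩ := form_ne_one_of_sphere hfS hgS hr h
    simp only [segmentLength]
    have h4 := (Real.hasDerivAt_arccos h2 h3).comp s (hasDerivAt_form (S := sphere) hf hg)
    refine h4.congr_deriv ?_
    rw [h1, Real.sqrt_sq hr.le, form_sub_right, form_sub_right, form_smul_right,
      form_smul_right]
    have e1 : sphere.form f' (f s) = 0 := by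
      rw [← hf']; simp only [polar, form, curvature]; ring
    have e2 : sphere.form g' (g s) = 0 := by
      rw [← hg']; simp only [polar, form, curvature]; ring
    rw [e1, e2, form_comm _ g']
    field_simp
    ring
  · have h1 := one_lt_neg_form hfS hgS hr h
    have h2 := polar_sq_add hfS hgS h
    simp only [segmentLength]
    have h4 := (Real.hasDerivAt_arcosh h1).comp s (hasDerivAt_form (S := hyperbolic) hf hg).neg
    refine h4.congr_deriv ?_
    have hco : hyperbolic.polar (f s) (g s) = -hyperbolic.form (f s) (g s) := by
      simp only [polar, form, curvature]; ring
    have h5 : (-hyperbolic.form (f s) (g s)) ^ 2 - 1 = r ^ 2 := by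
      rw [hco] at h2; simp only [curvature] at h2; linarith
    rw [h5, Real.sqrt_sq hr.le, form_sub_right, form_sub_right, form_smul_right,
      form_smul_right]
    have e1 : hyperbolic.form f' (f s) = 0 := by
      rw [← neg_eq_zero, ← hf']; simp only [polar, form, curvature]; ring
    have e2 : hyperbolic.form g' (g s) = 0 := by
      rw [← neg_eq_zero, ← hg']; simp only [polar, form, curvature]; ring
    rw [e1, e2, form_comm _ g']
    field_simp
    ring

end Distance

/-! ### The triangle formed by two geodesics and their points of tangency -/

section Triangle

variable {S : SpaceForm} {X X' Y Y' C Z : Fin 3 → ℝ} {p q : ℝ}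

/-- `C` is the common point of the geodesic through `X` with direction `X'` and the geodesic through
`Y` with direction `Y'`, and `X`, `Y` do not lie on the geodesic of the other. The numbers `p`, `q`
give the position of `C` on the two geodesics, with a sign. -/
structure IsTangentTriangle (S : SpaceForm) (X X' Y Y' C : Fin 3 → ℝ) (p q : ℝ) : Prop where
  left_mem : X ∈ S.surface
  right_mem : Y ∈ S.surface
  apex_mem : C ∈ S.surface
  left_tangent : S.polar X X' = 0
  right_tangent : S.polar Y Y' = 0
  apex_eq_left : C = S.polar X C • X + p • X'
  apex_eq_right : C = S.polar Y C • Y + q • Y'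
  left_ne : p ≠ 0
  right_ne : q ≠ 0
  left_triple_ne : (X ⨯₃ X') ⬝ᵥ Y ≠ 0
  right_triple_ne : (Y ⨯₃ Y') ⬝ᵥ X ≠ 0

/-- The tangent vector at `C` of the geodesic that comes from `X`. Its length is the sine (length,
hyperbolic sine) of `|XC|`. -/
def exitVector (S : SpaceForm) (X C : Fin 3 → ℝ) : Fin 3 → ℝ := S.polar X C • C - X

lemma form_exitVector_self (hX : X ∈ S.surface) (hC : C ∈ S.surface) :
    S.form (S.exitVector X C) (S.exitVector X C) =
      S.form (C - S.polar X C • X) (C - S.polar X C • X) := by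
  have h : (1 - S.polar X C ^ 2) * (S.form C C - S.form X X) = 0 := by
    have h1 := polar_self hX
    have h2 := polar_self hC
    cases S
    · simp only [surface, mem_ofPred_eq] at hX hC
      simp [polar, curvature, hX, hC]
    · have e : sphere.form C C - sphere.form X X = sphere.polar C C - sphere.polar X X := by
        simp only [polar, form, curvature]; ring
      rw [e, h1, h2]; ring
    · have e : hyperbolic.form C C - hyperbolic.form X X =
          hyperbolic.polar X X - hyperbolic.polar C C := by
        simp only [polar, form, curvature]; ring
      rw [e, h1, h2]; ring
  simp only [exitVector, form_sub_left, form_sub_right, form_smul_left, form_smul_right,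
    S.form_comm X C] at h ⊢
  linear_combination -h

lemma polar_exitVector (hC : C ∈ S.surface) : S.polar C (S.exitVector X C) = 0 := by
  rw [exitVector, polar_sub_right, polar_smul_right, polar_self hC, S.polar_comm C X]; ring

lemma speed_pos (hX : X ∈ S.surface) (h : S.polar X X' = 0) (h0 : X' ≠ 0) : 0 < S.speed X' :=
  Real.sqrt_pos.2 (form_tangent_pos hX h h0)

lemma speed_sq (hX : X ∈ S.surface) (h : S.polar X X' = 0) (h0 : X' ≠ 0) :
    S.speed X' ^ 2 = S.form X' X' :=
  Real.sq_sqrt (form_tangent_pos hX h h0).le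

namespace IsTangentTriangle

lemma symm (h : S.IsTangentTriangle X X' Y Y' C p q) : S.IsTangentTriangle Y Y' X X' C q p :=
  ⟨h.2, h.1, h.3, h.5, h.4, h.7, h.6, h.9, h.8, h.11, h.10⟩

lemma left_ne_zero (h : S.IsTangentTriangle X X' Y Y' C p q) : X' ≠ 0 := by
  rintro rfl
  exact h.left_triple_ne (by simp)

lemma left_speed_pos (h : S.IsTangentTriangle X X' Y Y' C p q) : 0 < S.speed X' :=
  speed_pos h.left_mem h.left_tangent h.left_ne_zero

lemma form_left (h : S.IsTangentTriangle X X' Y Y' C p q) :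
    S.form (C - S.polar X C • X) (C - S.polar X C • X) = (|p| * S.speed X') ^ 2 := by
  have e : C - S.polar X C • X = p • X' := by
    nth_rewrite 1 [h.apex_eq_left]; simp
  rw [e, form_smul_left, form_smul_right, mul_pow, sq_abs,
    speed_sq h.left_mem h.left_tangent h.left_ne_zero]
  ring

lemma left_pos (h : S.IsTangentTriangle X X' Y Y' C p q) : 0 < |p| * S.speed X' :=
  mul_pos (abs_pos.2 h.left_ne) h.left_speed_pos

lemma normal_left_apex (h : S.IsTangentTriangle X X' Y Y' C p q) : (X ⨯₃ X') ⬝ᵥ C = 0 := by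
  rw [h.apex_eq_left, dotProduct_add, dotProduct_smul, dotProduct_smul, dotProduct_comm,
    dot_self_cross, dotProduct_comm, dot_cross_self]
  simp

/-- `1 + cos φ`, where `φ` is the angle at the apex between the two geodesics, both directed away
from the tangency points. -/
def angleFactor (S : SpaceForm) (X X' Y Y' C : Fin 3 → ℝ) (p q : ℝ) : ℝ :=
  1 + S.form (S.exitVector X C) (S.exitVector Y C) / ((|p| * S.speed X') * (|q| * S.speed Y'))

lemma angleFactor_symm :
    angleFactor S Y Y' X X' C q p = angleFactor S X X' Y Y' C p q := by
  rw [angleFactor, angleFactor, form_comm, mul_comm (|p| * _)]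

lemma angleFactor_pos (h : S.IsTangentTriangle X X' Y Y' C p q) :
    0 < angleFactor S X X' Y Y' C p q := by
  have hr := h.left_pos
  have hr' := h.symm.left_pos
  rw [angleFactor]
  have hx := (form_exitVector_self h.left_mem h.apex_mem).trans h.form_left
  have hy := (form_exitVector_self h.right_mem h.apex_mem).trans h.symm.form_left
  set r := |p| * S.speed X'
  set r' := |q| * S.speed Y'
  have hz : S.polar C (r⁻¹ • S.exitVector X C + r'⁻¹ • S.exitVector Y C) = 0 := by
    rw [polar_add_right, polar_smul_right, polar_smul_right, polar_exitVector h.apex_mem,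
      polar_exitVector h.apex_mem]; ring
  -- The two unit vectors are not opposite: one is tangent to the geodesic of `Y`, the other is not.
  have hne : r⁻¹ • S.exitVector X C + r'⁻¹ • S.exitVector Y C ≠ 0 := by
    intro h0
    have h1 := congrArg (fun z => (Y ⨯₃ Y') ⬝ᵥ z) h0
    have h2 : (Y ⨯₃ Y') ⬝ᵥ Y = 0 := by rw [dotProduct_comm, dot_self_cross]
    simp only [exitVector, dotProduct_add, dotProduct_smul, dotProduct_sub,
      h.symm.normal_left_apex, h2, smul_eq_mul, dotProduct_zero] at h1
    have h3 : r⁻¹ * ((Y ⨯₃ Y') ⬝ᵥ X) = 0 := by linarith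
    rcases mul_eq_zero.1 h3 with h4 | h4
    · exact (inv_pos.2 hr).ne' h4
    · exact h.right_triple_ne h4
  have hpos := form_tangent_pos h.apex_mem hz hne
  rw [form_add_left, form_add_right, form_add_right, form_smul_left, form_smul_left,
    form_smul_left, form_smul_left, form_smul_right, form_smul_right, form_smul_right,
    form_smul_right, hx, hy, form_comm _ (S.exitVector Y C)] at hpos
  have e : r⁻¹ * (r⁻¹ * r ^ 2) + r⁻¹ * (r'⁻¹ * S.form (S.exitVector X C) (S.exitVector Y C)) +
      (r'⁻¹ * (r⁻¹ * S.form (S.exitVector X C) (S.exitVector Y C)) + r'⁻¹ * (r'⁻¹ * r' ^ 2)) =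
      2 * (1 + S.form (S.exitVector X C) (S.exitVector Y C) / (r * r')) := by
    field_simp; ring
  rw [e] at hpos
  linarith

/-- A velocity of the apex that keeps it on the geodesic of `Y` is a multiple of the direction of
this geodesic; the factor is found by pairing with the normal of the plane of the other geodesic. -/
lemma apex_velocity_eq (h : S.IsTangentTriangle X X' Y Y' C p q) (hZ : S.polar C Z = 0)
    (hYZ : (Y ⨯₃ Y') ⬝ᵥ Z = 0) :
    Z = (-((X ⨯₃ X') ⬝ᵥ Z) / ((X ⨯₃ X') ⬝ᵥ Y)) • S.exitVector Y C := by
  have hE := h.left_triple_ne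
  have hd : C ⬝ᵥ Y ⨯₃ X = q * ((Y ⨯₃ Y') ⬝ᵥ X) * (-1) := by
    nth_rewrite 1 [h.apex_eq_right]
    simp [cross_apply, dotProduct, Fin.sum_univ_three]; ring
  have h0 : C ⬝ᵥ Y ⨯₃ Z = 0 := by
    have : C ⬝ᵥ Y ⨯₃ Z = q * ((Y ⨯₃ Y') ⬝ᵥ Z) * (-1) := by
      nth_rewrite 1 [h.apex_eq_right]
      simp [cross_apply, dotProduct, Fin.sum_univ_three]; ring
    rw [this, hYZ]; ring
  have hd0 : C ⬝ᵥ Y ⨯₃ X ≠ 0 := by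
    rw [hd]
    exact mul_ne_zero (mul_ne_zero h.right_ne h.right_triple_ne) (by norm_num)
  obtain ⟨α, β, hαβ⟩ : ∃ α β : ℝ, Z = α • C + β • Y := by
    have := triple_smul_eq C Y X Z
    rw [h0, zero_smul, add_zero] at this
    refine ⟨(C ⬝ᵥ Y ⨯₃ X)⁻¹ * (Z ⬝ᵥ Y ⨯₃ X), (C ⬝ᵥ Y ⨯₃ X)⁻¹ * (C ⬝ᵥ Z ⨯₃ X), ?_⟩
    rw [mul_smul, mul_smul, ← smul_add, ← this, smul_smul, inv_mul_cancel₀ hd0, one_smul]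
  have h1 : α = -β * S.polar Y C := by
    rw [hαβ, polar_add_right, polar_smul_right, polar_smul_right, polar_self h.apex_mem,
      S.polar_comm C Y] at hZ
    linarith
  have h2 : Z = (-β) • S.exitVector Y C := by
    rw [hαβ, h1, exitVector, smul_sub, smul_smul]; module
  have h3 : (X ⨯₃ X') ⬝ᵥ Z = β * ((X ⨯₃ X') ⬝ᵥ Y) := by
    rw [h2, exitVector, dotProduct_smul, dotProduct_sub, dotProduct_smul, h.normal_left_apex]
    simp
  rw [h3, h2]
  congr 1
  field_simp

/-- The derivative of `|XC| + |YC|` when `X` moves along its curve, `Y` stays, and `C` is kept on the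
geodesic of `Y`. -/
lemma hasDerivAt_add_segmentLength (h : S.IsTangentTriangle X X' Y Y' C p q)
    {f g : ℝ → Fin 3 → ℝ} {s : ℝ} (hf : HasDerivAt f X' s) (hg : HasDerivAt g Z s)
    (hfs : f s = X) (hgs : g s = C) (hZ : S.polar C Z = 0) (hYZ : (Y ⨯₃ Y') ⬝ᵥ Z = 0) :
    HasDerivAt (fun u => S.segmentLength (f u) (g u) + S.segmentLength Y (g u))
      (-(p / |p|) * S.speed X' + -((X ⨯₃ X') ⬝ᵥ Z) / ((X ⨯₃ X') ⬝ᵥ Y) * (|q| * S.speed Y') *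
        angleFactor S X X' Y Y' C p q) s := by
  have hr := h.left_pos
  have hr' := h.symm.left_pos
  have hy := (form_exitVector_self h.right_mem h.apex_mem).trans h.symm.form_left
  have d1 := hasDerivAt_segmentLength (S := S) (r := |p| * S.speed X') hf hg
    (by rw [hfs]; exact h.left_mem) (by rw [hgs]; exact h.apex_mem)
    (by rw [hfs]; exact h.left_tangent) (by rw [hgs]; exact hZ) hr
    (by rw [hfs, hgs]; exact h.form_left)
  have d2 := hasDerivAt_segmentLength (S := S) (r := |q| * S.speed Y') (hasDerivAt_const s Y) hg
    h.right_mem (by rw [hgs]; exact h.apex_mem)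
    (by simp [polar]) (by rw [hgs]; exact hZ) hr'
    (by rw [hgs]; exact h.symm.form_left)
  refine (d1.add d2).congr_deriv ?_
  rw [hfs, hgs]
  have e1 : C - S.polar X C • X = p • X' := by
    nth_rewrite 1 [h.apex_eq_left]; simp
  have e2 : X - S.polar X C • C = (-1 : ℝ) • S.exitVector X C := by rw [exitVector]; module
  have e3 : Y - S.polar Y C • C = (-1 : ℝ) • S.exitVector Y C := by rw [exitVector]; module
  have e4 := h.apex_velocity_eq hZ hYZ
  set μ := -((X ⨯₃ X') ⬝ᵥ Z) / ((X ⨯₃ X') ⬝ᵥ Y)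
  have e5 : S.form 0 (C - S.polar Y C • Y) = 0 := by simp [form]
  rw [e1, e2, e3, e5, form_smul_right, form_smul_right, form_smul_right, e4, form_smul_left,
    form_smul_left, hy, ← speed_sq h.left_mem h.left_tangent h.left_ne_zero, angleFactor,
    form_comm _ (S.exitVector Y C)]
  have hp := abs_pos.2 h.left_ne
  have hq := abs_pos.2 h.right_ne
  have hv := h.left_speed_pos
  have hv' := h.symm.left_speed_pos
  field_simp
  ring

end IsTangentTriangle
end Triangle

/-! ### Curves on the surface -/

section Cross

lemma hasDerivAt_cross {f g : ℝ → Fin 3 → ℝ} {f' g' : Fin 3 → ℝ} {s : ℝ}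
    (hf : HasDerivAt f f' s) (hg : HasDerivAt g g' s) :
    HasDerivAt (fun u => f u ⨯₃ g u) (f' ⨯₃ g s + f s ⨯₃ g') s := by
  rw [hasDerivAt_pi] at hf hg ⊢
  intro i
  fin_cases i
  · refine (((hf 1).mul (hg 2)).sub ((hf 2).mul (hg 1))).congr_deriv ?_
    simp [cross_apply]; ring
  · refine (((hf 2).mul (hg 0)).sub ((hf 0).mul (hg 2))).congr_deriv ?_
    simp [cross_apply]; ring
  · refine (((hf 0).mul (hg 1)).sub ((hf 1).mul (hg 0))).congr_deriv ?_
    simp [cross_apply]; ring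

lemma contDiffAt_cross {E : Type*} [NormedAddCommGroup E] [NormedSpace ℝ E]
    {f g : E → Fin 3 → ℝ} {x : E} {n : WithTop ℕ∞}
    (hf : ContDiffAt ℝ n f x) (hg : ContDiffAt ℝ n g x) :
    ContDiffAt ℝ n (fun u => f u ⨯₃ g u) x := by
  rw [contDiffAt_pi] at hf hg ⊢
  intro i
  fin_cases i
  · exact ((hf 1).mul (hg 2)).sub ((hf 2).mul (hg 1))
  · exact ((hf 2).mul (hg 0)).sub ((hf 0).mul (hg 2))
  · exact ((hf 0).mul (hg 1)).sub ((hf 1).mul (hg 0))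

lemma continuous_cross : Continuous fun p : (Fin 3 → ℝ) × (Fin 3 → ℝ) => p.1 ⨯₃ p.2 := by
  rw [continuous_pi_iff]
  intro i
  fin_cases i <;> simp [cross_apply] <;> fun_prop

lemma hasDerivAt_dotProduct {f g : ℝ → Fin 3 → ℝ} {f' g' : Fin 3 → ℝ} {s : ℝ}
    (hf : HasDerivAt f f' s) (hg : HasDerivAt g g' s) :
    HasDerivAt (fun u => f u ⬝ᵥ g u) (f' ⬝ᵥ g s + f s ⬝ᵥ g') s := by
  rw [hasDerivAt_pi] at hf hg
  simp only [dotProduct, Fin.sum_univ_three]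
  refine ((((hf 0).mul (hg 0)).add ((hf 1).mul (hg 1))).add ((hf 2).mul (hg 2))).congr_deriv ?_
  ring

end Cross

section Curve

variable {S : SpaceForm} {c : ℝ → Fin 3 → ℝ} {k s a b : ℝ}

/-- The normal `c × c'` to the plane through the origin that cuts out the tangent geodesic. -/
def normal (c : ℝ → Fin 3 → ℝ) (s : ℝ) : Fin 3 → ℝ := c s ⨯₃ deriv c s

/-- The triple product `det (c, c', c'')`. -/
def wronskian (c : ℝ → Fin 3 → ℝ) (s : ℝ) : ℝ := normal c s ⬝ᵥ deriv (deriv c) s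

/-- Near the parameter `s`, the curve `c` is a `C²` curve on the surface, and at `s` it is curved:
its Wronskian has the same sign as the constant `k`. -/
structure IsCurvedAt (S : SpaceForm) (c : ℝ → Fin 3 → ℝ) (k s : ℝ) : Prop where
  contDiffAt : ContDiffAt ℝ 2 c s
  eventually_mem : ∀ᶠ u in 𝓝 s, c u ∈ S.surface
  pos : 0 < k * wronskian c s

lemma contDiffAt_deriv (h : ContDiffAt ℝ 2 c s) : ContDiffAt ℝ 1 (deriv c) s :=
  h.derivWithin (by norm_num)

lemma continuousAt_deriv_deriv (h : ContDiffAt ℝ 2 c s) : ContinuousAt (deriv (deriv c)) s :=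
  ((contDiffAt_deriv h).derivWithin (m := 0) (by norm_num)).continuousAt

lemma hasDerivAt_curve (h : ContDiffAt ℝ 2 c s) : HasDerivAt c (deriv c s) s :=
  (h.differentiableAt (by norm_num)).hasDerivAt

lemma hasDerivAt_velocity (h : ContDiffAt ℝ 2 c s) :
    HasDerivAt (deriv c) (deriv (deriv c) s) s :=
  ((contDiffAt_deriv h).differentiableAt (by norm_num)).hasDerivAt

lemma contDiffAt_normal (h : ContDiffAt ℝ 2 c s) : ContDiffAt ℝ 1 (normal c) s :=
  contDiffAt_cross (h.of_le (by norm_num)) (contDiffAt_deriv h)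

lemma hasDerivAt_normal (h : ContDiffAt ℝ 2 c s) :
    HasDerivAt (normal c) (c s ⨯₃ deriv (deriv c) s) s :=
  (hasDerivAt_cross (hasDerivAt_curve h) (hasDerivAt_velocity h)).congr_deriv (by simp)

lemma normal_dot_self (c : ℝ → Fin 3 → ℝ) (s : ℝ) : normal c s ⬝ᵥ c s = 0 := by
  rw [normal, dotProduct_comm, dot_self_cross]

lemma normal_dot_deriv (c : ℝ → Fin 3 → ℝ) (s : ℝ) : normal c s ⬝ᵥ deriv c s = 0 := by
  rw [normal, dotProduct_comm, dot_cross_self]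

lemma polar_deriv (h : ContDiffAt ℝ 2 c s) (hS : ∀ᶠ u in 𝓝 s, c u ∈ S.surface) :
    S.polar (c s) (deriv c s) = 0 := by
  have h1 := hasDerivAt_polar (S := S) (hasDerivAt_curve h) (hasDerivAt_curve h)
  have h2 : HasDerivAt (fun u => S.polar (c u) (c u)) 0 s :=
    (hasDerivAt_const s (1 : ℝ)).congr_of_eventuallyEq (hS.mono fun u hu => polar_self hu)
  have h3 := h1.unique h2
  rw [S.polar_comm (deriv c s)] at h3
  linarith

lemma eventually_polar_deriv (h : ContDiffAt ℝ 2 c s) (hS : ∀ᶠ u in 𝓝 s, c u ∈ S.surface) :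
    ∀ᶠ u in 𝓝 s, S.polar (c u) (deriv c u) = 0 := by
  filter_upwards [h.eventually (by simp), hS.eventually_nhds] with u h1 h2
  exact polar_deriv h1 h2

lemma polar_deriv_deriv (h : ContDiffAt ℝ 2 c s) (hS : ∀ᶠ u in 𝓝 s, c u ∈ S.surface) :
    S.polar (deriv c s) (deriv c s) + S.polar (c s) (deriv (deriv c) s) = 0 :=
  (hasDerivAt_polar (S := S) (hasDerivAt_curve h) (hasDerivAt_velocity h)).unique
    ((hasDerivAt_const s (0 : ℝ)).congr_of_eventuallyEq (eventually_polar_deriv h hS))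

lemma polar_covariantAcceleration (h : ContDiffAt ℝ 2 c s)
    (hS : ∀ᶠ u in 𝓝 s, c u ∈ S.surface) :
    S.polar (c s) (S.covariantAcceleration c s) = 0 := by
  have h1 := polar_deriv_deriv h hS
  have h2 := polar_deriv h hS
  have h3 := polar_self hS.self_of_nhds
  have h4 := polar_eq_of_tangent (w := deriv c s) hS.self_of_nhds h2
  rw [covariantAcceleration, polar_sub_right, polar_smul_right, h3]
  cases S
  · simp only [curvature] at *
    linarith
  · simp only [polar, form, curvature] at *
    linarith
  · simp only [polar, form, curvature] at *
    linarith

/-- For tangent vectors, the Gram determinant is the square of the triple product. -/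
lemma gram_eq_triple_sq {x v w : Fin 3 → ℝ} (hx : x ∈ S.surface) (hv : S.polar x v = 0)
    (hw : S.polar x w = 0) :
    S.form v v * S.form w w - S.form v w ^ 2 = ((x ⨯₃ v) ⬝ᵥ w) ^ 2 := by
  have hx1 := polar_self hx
  cases S
  · simp only [surface, mem_ofPred_eq] at hx
    simp only [polar, curvature, hx] at hv hw
    have hv2 : v 2 = 0 := by linarith
    have hw2 : w 2 = 0 := by linarith
    simp [form, curvature, cross_apply, dotProduct, Fin.sum_univ_three, hv2, hw2, hx]
    ring
  · simp [polar, form, curvature, cross_apply, dotProduct, Fin.sum_univ_three] at *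
    set A := v 0 * v 0 + v 1 * v 1 + v 2 * v 2
    set B := w 0 * w 0 + w 1 * w 1 + w 2 * w 2
    set G := v 0 * w 0 + v 1 * w 1 + v 2 * w 2
    have key : ((x 1 * v 2 - x 2 * v 1) * w 0 + (x 2 * v 0 - x 0 * v 2) * w 1 +
        (x 0 * v 1 - x 1 * v 0) * w 2) ^ 2 = (x 0 * x 0 + x 1 * x 1 + x 2 * x 2) * (A * B - G ^ 2)
        - (x 0 * v 0 + x 1 * v 1 + x 2 * v 2) * ((x 0 * v 0 + x 1 * v 1 + x 2 * v 2) * B -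
          G * (x 0 * w 0 + x 1 * w 1 + x 2 * w 2))
        + (x 0 * w 0 + x 1 * w 1 + x 2 * w 2) * ((x 0 * v 0 + x 1 * v 1 + x 2 * v 2) * G -
          A * (x 0 * w 0 + x 1 * w 1 + x 2 * w 2)) := by
      simp only [A, B, G]; ring
    rw [key, hx1, hv, hw]; ring
  · simp [polar, form, curvature, cross_apply, dotProduct, Fin.sum_univ_three] at *
    set A := v 0 * v 0 + v 1 * v 1 + -(v 2 * v 2)
    set B := w 0 * w 0 + w 1 * w 1 + -(w 2 * w 2)
    set G := v 0 * w 0 + v 1 * w 1 + -(v 2 * w 2)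
    have key : ((x 1 * v 2 - x 2 * v 1) * w 0 + (x 2 * v 0 - x 0 * v 2) * w 1 +
        (x 0 * v 1 - x 1 * v 0) * w 2) ^ 2 =
        (-(x 1 * x 1) + -(x 0 * x 0) + x 2 * x 2) * (A * B - G ^ 2)
        + (-(x 1 * v 1) + -(x 0 * v 0) + x 2 * v 2) *
          ((-(x 1 * v 1) + -(x 0 * v 0) + x 2 * v 2) * B -
            G * (-(x 1 * w 1) + -(x 0 * w 0) + x 2 * w 2))
        - (-(x 1 * w 1) + -(x 0 * w 0) + x 2 * w 2) *
          ((-(x 1 * v 1) + -(x 0 * v 0) + x 2 * v 2) * G -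
            A * (-(x 1 * w 1) + -(x 0 * w 0) + x 2 * w 2)) := by
      simp only [A, B, G]; ring
    rw [key, hx1, hv, hw]; ring

lemma wronskian_ne_zero (h : ContDiffAt ℝ 2 c s) (hS : ∀ᶠ u in 𝓝 s, c u ∈ S.surface)
    (hcurv : S.geodesicCurvature c s ≠ 0) : wronskian c s ≠ 0 := by
  intro h0
  apply hcurv
  have h1 : (c s ⨯₃ deriv c s) ⬝ᵥ S.covariantAcceleration c s = 0 := by
    rw [covariantAcceleration, dotProduct_sub, dotProduct_smul]
    have := normal_dot_self c s
    simp only [wronskian, normal] at h0 this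
    rw [h0, this]; simp
  rw [geodesicCurvature, gram_eq_triple_sq hS.self_of_nhds (polar_deriv h hS)
    (polar_covariantAcceleration h hS), h1]
  simp

lemma continuousAt_dotProduct {X : Type*} [TopologicalSpace X] {f g : X → Fin 3 → ℝ} {x : X}
    (hf : ContinuousAt f x) (hg : ContinuousAt g x) : ContinuousAt (fun u => f u ⬝ᵥ g u) x := by
  have : Continuous fun p : (Fin 3 → ℝ) × (Fin 3 → ℝ) => p.1 ⬝ᵥ p.2 := by
    simp only [dotProduct, Fin.sum_univ_three]; fun_prop
  exact this.continuousAt.comp (hf.prodMk hg)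

namespace IsCurvedAt

lemma mem (h : S.IsCurvedAt c k s) : c s ∈ S.surface := h.eventually_mem.self_of_nhds

lemma polar_deriv (h : S.IsCurvedAt c k s) : S.polar (c s) (deriv c s) = 0 :=
  SpaceForm.polar_deriv h.contDiffAt h.eventually_mem

lemma deriv_ne_zero (h : S.IsCurvedAt c k s) : deriv c s ≠ 0 := by
  intro h0
  have := h.pos
  simp [wronskian, normal, h0] at this

lemma eventually (h : S.IsCurvedAt c k s) : ∀ᶠ u in 𝓝 s, S.IsCurvedAt c k u := by
  have hcont : ContinuousAt (fun u => k * wronskian c u) s :=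
    continuousAt_const.mul (continuousAt_dotProduct
      (contDiffAt_normal h.contDiffAt).continuousAt (continuousAt_deriv_deriv h.contDiffAt))
  filter_upwards [h.contDiffAt.eventually (by simp), h.eventually_mem.eventually_nhds,
    hcont.eventually (lt_mem_nhds h.pos)] with u h1 h2 h3
  exact ⟨h1, h2, h3⟩

end IsCurvedAt

end Curve

/-! ### The intersection point of two tangent geodesics -/

section Arc

variable {S : SpaceForm} {c : ℝ → Fin 3 → ℝ} {k s a b δ : ℝ}

/-- The height of `c b` over the plane of the tangent geodesic at `c a`, scaled by the constant `k`
so that it is positive on a curved arc. -/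
def height (c : ℝ → Fin 3 → ℝ) (k a b : ℝ) : ℝ := k * (normal c a ⬝ᵥ c b)

/-- A vector on the intersection line of the planes of the tangent geodesics at `c a` and `c b`. For
`b < a` and `k` with the sign of the Wronskian it points to the side of the curve. -/
def pole (c : ℝ → Fin 3 → ℝ) (k a b : ℝ) : Fin 3 → ℝ := k • (normal c b ⨯₃ normal c a)

/-- The intersection point, close to the curve, of the tangent geodesics at `c a` and `c b`. -/
def apex (S : SpaceForm) (c : ℝ → Fin 3 → ℝ) (k a b : ℝ) : Fin 3 → ℝ := S.normalize (pole c k a b)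

lemma pole_eq_left (c : ℝ → Fin 3 → ℝ) (k a b : ℝ) :
    pole c k a b = (k * (normal c b ⬝ᵥ deriv c a)) • c a - height c k b a • deriv c a := by
  rw [pole, normal.eq_1 c a, cross_cross_right, smul_sub, smul_smul, smul_smul, height]

lemma pole_eq_right (c : ℝ → Fin 3 → ℝ) (k a b : ℝ) :
    pole c k a b = height c k a b • deriv c b - (k * (normal c a ⬝ᵥ deriv c b)) • c b := by
  rw [pole, normal.eq_1 c b, cross_cross_left, smul_sub, smul_smul, smul_smul, height]

/-- An arc with parameters in `(-δ, δ)` that is so short that it lies on one side of each of its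
tangent geodesics, and that any two of these meet on the surface. -/
structure IsCurvedArc (S : SpaceForm) (c : ℝ → Fin 3 → ℝ) (k δ : ℝ) : Prop where
  curved : ∀ s ∈ Ioo (-δ) δ, S.IsCurvedAt c k s
  height_pos : ∀ a ∈ Ioo (-δ) δ, ∀ b ∈ Ioo (-δ) δ, a ≠ b → 0 < height c k a b
  pole_mem : ∀ a ∈ Ioo (-δ) δ, ∀ b ∈ Ioo (-δ) δ, b < a → pole c k a b ∈ S.cone

/-- The Taylor remainder argument: `b ↦ height c k a b` vanishes to the second order at `a` and has a
positive second derivative. -/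
lemma height_pos_of_forall (hc : ∀ s ∈ Ioo (-δ) δ, ContDiffAt ℝ 2 c s)
    (hpos : ∀ s ∈ Ioo (-δ) δ, 0 < k * (normal c a ⬝ᵥ deriv (deriv c) s))
    (ha : a ∈ Ioo (-δ) δ) (hb : b ∈ Ioo (-δ) δ) (hab : a ≠ b) : 0 < height c k a b := by
  have hsub : ∀ u ∈ Ioo (-δ) δ, ∀ v ∈ Ioo (-δ) δ, Icc u v ⊆ Ioo (-δ) δ := fun u hu v hv x hx =>
    ⟨hu.1.trans_le hx.1, hx.2.trans_lt hv.2⟩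
  have d0 : ∀ s ∈ Ioo (-δ) δ,
      HasDerivAt (fun u => height c k a u) (k * (normal c a ⬝ᵥ deriv c s)) s := fun s hs => by
    simpa [height] using
      (hasDerivAt_dotProduct (hasDerivAt_const s (normal c a))
        (hasDerivAt_curve (hc s hs))).const_mul k
  have d1 : ∀ s ∈ Ioo (-δ) δ, HasDerivAt (fun u => k * (normal c a ⬝ᵥ deriv c u))
      (k * (normal c a ⬝ᵥ deriv (deriv c) s)) s := fun s hs => by
    simpa using
      (hasDerivAt_dotProduct (hasDerivAt_const s (normal c a))
        (hasDerivAt_velocity (hc s hs))).const_mul k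
  have mono : StrictMonoOn (fun u => k * (normal c a ⬝ᵥ deriv c u)) (Ioo (-δ) δ) := by
    refine strictMonoOn_of_deriv_pos (convex_Ioo _ _)
      (fun x hx => (d1 x hx).continuousAt.continuousWithinAt) fun x hx => ?_
    rw [interior_Ioo] at hx
    rw [(d1 x hx).deriv]
    exact hpos x hx
  have z0 : height c k a a = 0 := by rw [height, normal_dot_self, mul_zero]
  have z1 : k * (normal c a ⬝ᵥ deriv c a) = 0 := by rw [normal_dot_deriv, mul_zero]
  rcases hab.lt_or_gt with h | h
  · obtain ⟨ξ, hξ, e⟩ := exists_hasDerivAt_eq_slope _ _ h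
      (fun x hx => (d0 x (hsub a ha b hb hx)).continuousAt.continuousWithinAt)
      (fun x hx => d0 x (hsub a ha b hb (Ioo_subset_Icc_self hx)))
    have h1 := mono ha (hsub a ha b hb (Ioo_subset_Icc_self hξ)) hξ.1
    simp only [z1] at h1
    rw [z0, sub_zero, eq_div_iff (sub_pos.2 h).ne'] at e
    rw [← e]
    exact mul_pos h1 (sub_pos.2 h)
  · obtain ⟨ξ, hξ, e⟩ := exists_hasDerivAt_eq_slope _ _ h
      (fun x hx => (d0 x (hsub b hb a ha hx)).continuousAt.continuousWithinAt)
      (fun x hx => d0 x (hsub b hb a ha (Ioo_subset_Icc_self hx)))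
    have h1 := mono (hsub b hb a ha (Ioo_subset_Icc_self hξ)) ha hξ.2
    simp only [z1] at h1
    rw [z0, zero_sub, eq_div_iff (sub_pos.2 h).ne'] at e
    nlinarith [sub_pos.2 h]

lemma eventually_Ioo_prod {P : ℝ × ℝ → Prop} (h : ∀ᶠ p in 𝓝 ((0 : ℝ), (0 : ℝ)), P p) :
    ∀ᶠ δ in 𝓝[>] (0 : ℝ), ∀ a ∈ Ioo (-δ) δ, ∀ b ∈ Ioo (-δ) δ, P (a, b) := by
  obtain ⟨ε, hε, H⟩ := Metric.eventually_nhds_iff.1 h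
  filter_upwards [Ioo_mem_nhdsGT hε] with δ hδ a ha b hb
  apply H
  rw [Prod.dist_eq, max_lt_iff, Real.dist_eq, Real.dist_eq, sub_zero, sub_zero, abs_lt, abs_lt]
  exact ⟨⟨by linarith [ha.1, hδ.2], by linarith [ha.2, hδ.2]⟩,
    ⟨by linarith [hb.1, hδ.2], by linarith [hb.2, hδ.2]⟩⟩

/-- The ordered pairs of parameters close to `s`. -/
def pairs (s : ℝ) : Filter (ℝ × ℝ) := 𝓝 (s, s) ⊓ 𝓟 {p | p.2 < p.1}

/-- `N(b) × N(a) ≈ (a - b) N × N' = (a - b) D c`, by the strict differentiability of `N = c × c'`. -/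
lemma tendsto_pole (h : S.IsCurvedAt c k s) :
    Tendsto (fun p : ℝ × ℝ => (p.1 - p.2)⁻¹ • pole c k p.1 p.2) (pairs s)
      (𝓝 ((k * wronskian c s) • c s)) := by
  have hN := contDiffAt_normal h.contDiffAt
  have hd : HasStrictDerivAt (normal c) (c s ⨯₃ deriv (deriv c) s) s := by
    have := hN.hasStrictDerivAt (by norm_num)
    rwa [(hasDerivAt_normal h.contDiffAt).deriv] at this
  have h1 : Tendsto (fun p : ℝ × ℝ => (p.1 - p.2)⁻¹ • (normal c p.1 - normal c p.2)) (pairs s)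
      (𝓝 (c s ⨯₃ deriv (deriv c) s)) := by
    have h2 := (hd.hasStrictFDerivAt.isLittleO).mono (inf_le_left : pairs s ≤ _)
    have h3 := h2.tendsto_inv_smul_nhds_zero.add_const (c s ⨯₃ deriv (deriv c) s)
    rw [zero_add] at h3
    refine h3.congr' ?_
    have : ∀ᶠ p : ℝ × ℝ in pairs s, p.2 < p.1 := mem_inf_of_right (mem_principal_self _)
    filter_upwards [this] with p hp
    have hp' : p.1 - p.2 ≠ 0 := (sub_pos.2 hp).ne'
    simp only [ContinuousLinearMap.toSpanSingleton_apply, smul_sub, smul_smul,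
      inv_mul_cancel₀ hp', one_smul]
    abel
  have h2 : Tendsto (fun p : ℝ × ℝ => normal c p.2) (pairs s) (𝓝 (normal c s)) :=
    (hN.continuousAt.tendsto.comp (continuous_snd.tendsto (s, s))).mono_left inf_le_left
  have h3 := ((continuous_cross.tendsto (normal c s, c s ⨯₃ deriv (deriv c) s)).comp
    (h2.prodMk_nhds h1)).const_smul k
  have e : k • (normal c s ⨯₃ (c s ⨯₃ deriv (deriv c) s)) = (k * wronskian c s) • c s := by
    rw [cross_cross_right, normal_dot_self, zero_smul, sub_zero, smul_smul, wronskian]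
  simp only [e] at h3
  refine h3.congr fun p => ?_
  simp only [Function.comp_apply, pole, map_smul, map_sub, cross_self, sub_zero]
  rw [smul_comm]

lemma eventually_pole_mem (h : S.IsCurvedAt c k s) :
    ∀ᶠ p : ℝ × ℝ in pairs s, pole c k p.1 p.2 ∈ S.cone := by
  have h1 := (tendsto_pole h).eventually (isOpen_cone.mem_nhds
    ((smul_mem_cone h.pos).2 (surface_subset_cone h.mem)))
  have h2 : ∀ᶠ p : ℝ × ℝ in pairs s, p.2 < p.1 := mem_inf_of_right (mem_principal_self _)
  filter_upwards [h1, h2] with p hp hp2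
  exact (smul_mem_cone (inv_pos.2 (sub_pos.2 hp2))).1 hp

lemma tendsto_apex (h : S.IsCurvedAt c k s) :
    Tendsto (fun p : ℝ × ℝ => S.apex c k p.1 p.2) (pairs s) (𝓝 (c s)) := by
  have hcone := (smul_mem_cone h.pos).2 (surface_subset_cone h.mem)
  have h1 := (contDiffAt_normalize hcone).continuousAt.tendsto.comp (tendsto_pole h)
  rw [normalize_smul h.pos, normalize_eq_self h.mem] at h1
  refine h1.congr' ?_
  have h2 : ∀ᶠ p : ℝ × ℝ in pairs s, p.2 < p.1 := mem_inf_of_right (mem_principal_self _)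
  filter_upwards [h2] with p hp
  exact normalize_smul (inv_pos.2 (sub_pos.2 hp))

lemma eventually_isCurvedArc (h : S.IsCurvedAt c k 0) :
    ∀ᶠ δ in 𝓝[>] (0 : ℝ), S.IsCurvedArc c k δ := by
  have h1 : ∀ᶠ p : ℝ × ℝ in 𝓝 (0, 0), S.IsCurvedAt c k p.1 :=
    (continuous_fst.tendsto ((0 : ℝ), (0 : ℝ))).eventually h.eventually
  have h2 : ∀ᶠ p : ℝ × ℝ in 𝓝 (0, 0), 0 < k * (normal c p.1 ⬝ᵥ deriv (deriv c) p.2) := by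
    have hN := (contDiffAt_normal h.contDiffAt).continuousAt
    have hD := continuousAt_deriv_deriv h.contDiffAt
    have : ContinuousAt (fun p : ℝ × ℝ => k * (normal c p.1 ⬝ᵥ deriv (deriv c) p.2)) (0, 0) :=
      continuousAt_const.mul (continuousAt_dotProduct
        (f := fun p : ℝ × ℝ => normal c p.1) (g := fun p : ℝ × ℝ => deriv (deriv c) p.2)
        (hN.comp_of_eq continuousAt_fst rfl) (hD.comp_of_eq continuousAt_snd rfl))
    exact this.eventually (lt_mem_nhds h.pos)
  have h3 : ∀ᶠ p : ℝ × ℝ in 𝓝 (0, 0), p.2 < p.1 → pole c k p.1 p.2 ∈ S.cone :=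
    eventually_inf_principal.1 (eventually_pole_mem h)
  filter_upwards [eventually_Ioo_prod h1, eventually_Ioo_prod h2, eventually_Ioo_prod h3]
    with δ H1 H2 H3
  exact ⟨fun s hs => H1 s hs s hs, fun a ha b hb hab =>
    height_pos_of_forall (fun s hs => (H1 s hs s hs).contDiffAt) (H2 a ha) ha hb hab, H3⟩

end Arc

section StringLength

variable {S : SpaceForm} {c : ℝ → Fin 3 → ℝ} {k s a b δ : ℝ}

lemma continuous_speed : Continuous S.speed := by
  unfold speed form; fun_prop

namespace IsCurvedArc

variable (h : S.IsCurvedArc c k δ) (ha : a ∈ Ioo (-δ) δ) (hb : b ∈ Ioo (-δ) δ) (hab : b < a)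

include h ha hb hab

lemma sqrt_pos : 0 < √(S.polar (pole c k a b) (pole c k a b)) :=
  Real.sqrt_pos.2 (h.pole_mem a ha b hb hab).1

lemma apex_mem : S.apex c k a b ∈ S.surface := normalize_mem (h.pole_mem a ha b hb hab)

lemma isTangentTriangle :
    S.IsTangentTriangle (c a) (deriv c a) (c b) (deriv c b) (S.apex c k a b)
      (-(height c k b a / √(S.polar (pole c k a b) (pole c k a b))))
      (height c k a b / √(S.polar (pole c k a b) (pole c k a b))) := by
  have hg := h.sqrt_pos ha hb hab
  have hA := h.curved a ha
  have hB := h.curved b hb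
  have e1 := h.height_pos a ha b hb hab.ne'
  have e2 := h.height_pos b hb a ha hab.ne
  have hC := h.apex_mem ha hb hab
  set g := √(S.polar (pole c k a b) (pole c k a b)) with hgdef
  have el : S.apex c k a b = (g⁻¹ * (k * (normal c b ⬝ᵥ deriv c a))) • c a +
      (-(height c k b a / g)) • deriv c a := by
    rw [apex, normalize, ← hgdef, pole_eq_left]
    module
  have er : S.apex c k a b = (-(g⁻¹ * (k * (normal c a ⬝ᵥ deriv c b)))) • c b +
      (height c k a b / g) • deriv c b := by
    rw [apex, normalize, ← hgdef, pole_eq_right]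
    module
  refine ⟨hA.mem, hB.mem, hC, hA.polar_deriv, hB.polar_deriv, ?_, ?_,
    neg_ne_zero.2 (div_pos e2 hg).ne', (div_pos e1 hg).ne',
    right_ne_zero_of_mul e1.ne', right_ne_zero_of_mul e2.ne'⟩
  · have : S.polar (c a) (S.apex c k a b) = g⁻¹ * (k * (normal c b ⬝ᵥ deriv c a)) := by
      rw [el, polar_add_right, polar_smul_right, polar_smul_right, hA.polar_deriv,
        polar_self hA.mem]; ring
    rw [this]; exact el
  · have : S.polar (c b) (S.apex c k a b) = -(g⁻¹ * (k * (normal c a ⬝ᵥ deriv c b))) := by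
      rw [er, polar_add_right, polar_smul_right, polar_smul_right, hB.polar_deriv,
        polar_self hB.mem]; ring
    rw [this]; exact er

lemma apex_mem_tangentGeodesic :
    S.apex c k a b ∈ S.tangentGeodesic c a ∧ S.apex c k a b ∈ S.tangentGeodesic c b := by
  have ht := h.isTangentTriangle ha hb hab
  exact ⟨⟨ht.apex_mem, Submodule.mem_span_pair.2 ⟨_, _, ht.apex_eq_left.symm⟩⟩,
    ⟨ht.apex_mem, Submodule.mem_span_pair.2 ⟨_, _, ht.apex_eq_right.symm⟩⟩⟩

omit hab in
lemma contDiffAt_pole :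
    ContDiffAt ℝ 1 (fun p : ℝ × ℝ => pole c k p.1 p.2) (a, b) := by
  have h1 : ContDiffAt ℝ 1 (fun p : ℝ × ℝ => normal c p.1) (a, b) :=
    ContDiffAt.comp (a, b) (contDiffAt_normal (h.curved a ha).contDiffAt) contDiffAt_fst
  have h2 : ContDiffAt ℝ 1 (fun p : ℝ × ℝ => normal c p.2) (a, b) :=
    ContDiffAt.comp (a, b) (contDiffAt_normal (h.curved b hb).contDiffAt) contDiffAt_snd
  exact (contDiffAt_cross h2 h1).const_smul k

lemma contDiffAt_apex :
    ContDiffAt ℝ 1 (fun p : ℝ × ℝ => S.apex c k p.1 p.2) (a, b) :=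
  ContDiffAt.comp (a, b) (contDiffAt_normalize (h.pole_mem a ha b hb hab))
    (h.contDiffAt_pole ha hb)

end IsCurvedArc

end StringLength

/-! ### The string length and its differential -/

section StringLength

variable {S : SpaceForm} {c : ℝ → Fin 3 → ℝ} {k s a b δ : ℝ}

/-- The length `|AC| + |BC|` of the two tangent segments from the apex to the points with parameters
`a` and `b`. -/
def tangentLength (S : SpaceForm) (c : ℝ → Fin 3 → ℝ) (k a b : ℝ) : ℝ :=
  S.segmentLength (c a) (S.apex c k a b) + S.segmentLength (c b) (S.apex c k a b)

lemma stringL_apex :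
    S.stringL c a b (S.apex c k a b) = S.tangentLength c k a b - S.arcLength c b a := rfl

/-- The derivative of `|XC| + |YC|` when `X` moves along a curved arc and `C` is the intersection
point of the tangent geodesic at `X` with the fixed geodesic of `Y`. -/
lemma hasDerivAt_add_segmentLength_of_apex {Y Y' C Z : Fin 3 → ℝ} {p q : ℝ}
    (hc : S.IsCurvedAt c k s) (h : S.IsTangentTriangle (c s) (deriv c s) Y Y' C p q)
    {g : ℝ → Fin 3 → ℝ} (hg : HasDerivAt g Z s) (hgs : g s = C)
    (h1 : ∀ᶠ u in 𝓝 s, S.polar (g u) (g u) = 1) (h2 : ∀ᶠ u in 𝓝 s, normal c u ⬝ᵥ g u = 0)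
    (h3 : ∀ᶠ u in 𝓝 s, (Y ⨯₃ Y') ⬝ᵥ g u = 0) :
    HasDerivAt (fun u => S.segmentLength (c u) (g u) + S.segmentLength Y (g u))
      (-(p / |p|) * S.speed (deriv c s) + -(p * wronskian c s) / (normal c s ⬝ᵥ Y) *
        (|q| * S.speed Y') *
        IsTangentTriangle.angleFactor S (c s) (deriv c s) Y Y' C p q) s := by
  have hZ : S.polar C Z = 0 := by
    have e := (hasDerivAt_polar (S := S) hg hg).unique
      ((hasDerivAt_const s (1 : ℝ)).congr_of_eventuallyEq h1)
    rw [hgs, S.polar_comm Z] at e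
    linarith
  have hYZ : (Y ⨯₃ Y') ⬝ᵥ Z = 0 := by
    have e := (hasDerivAt_dotProduct (hasDerivAt_const s (Y ⨯₃ Y')) hg).unique
      ((hasDerivAt_const s (0 : ℝ)).congr_of_eventuallyEq h3)
    simpa using e
  have hXZ : normal c s ⬝ᵥ Z = p * wronskian c s := by
    have e := (hasDerivAt_dotProduct (hasDerivAt_normal hc.contDiffAt) hg).unique
      ((hasDerivAt_const s (0 : ℝ)).congr_of_eventuallyEq h2)
    have e1 : (c s ⨯₃ deriv (deriv c) s) ⬝ᵥ C = -(p * wronskian c s) := by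
      rw [h.apex_eq_left, dotProduct_add, dotProduct_smul, dotProduct_smul,
        dotProduct_comm _ (c s), dot_self_cross, wronskian, normal]
      simp [cross_apply, dotProduct, Fin.sum_univ_three]; ring
    rw [hgs, e1] at e
    linarith
  have := h.hasDerivAt_add_segmentLength (hasDerivAt_curve hc.contDiffAt) hg rfl hgs hZ hYZ
  rwa [← normal.eq_1, hXZ] at this

lemma normal_dot_apex_left (c : ℝ → Fin 3 → ℝ) (k a b : ℝ) :
    normal c a ⬝ᵥ S.apex c k a b = 0 := by
  rw [apex, normalize, pole, dotProduct_smul, dotProduct_smul, dot_cross_self]; simp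

lemma normal_dot_apex_right (c : ℝ → Fin 3 → ℝ) (k a b : ℝ) :
    normal c b ⬝ᵥ S.apex c k a b = 0 := by
  rw [apex, normalize, pole, dotProduct_smul, dotProduct_smul, dot_self_cross]; simp

/-- The common factor of the two partial derivatives of the string length. -/
def stringFactor (S : SpaceForm) (c : ℝ → Fin 3 → ℝ) (k a b : ℝ) : ℝ :=
  IsTangentTriangle.angleFactor S (c a) (deriv c a) (c b) (deriv c b) (S.apex c k a b)
    (-(height c k b a / √(S.polar (pole c k a b) (pole c k a b))))
    (height c k a b / √(S.polar (pole c k a b) (pole c k a b))) /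
    S.polar (pole c k a b) (pole c k a b)

namespace IsCurvedArc

variable (h : S.IsCurvedArc c k δ) (ha : a ∈ Ioo (-δ) δ) (hb : b ∈ Ioo (-δ) δ) (hab : b < a)

include h ha hb hab

lemma stringFactor_pos : 0 < S.stringFactor c k a b :=
  div_pos (h.isTangentTriangle ha hb hab).angleFactor_pos (h.pole_mem a ha b hb hab).1

lemma eventually_apex :
    ∀ᶠ p : ℝ × ℝ in 𝓝 (a, b), S.polar (S.apex c k p.1 p.2) (S.apex c k p.1 p.2) = 1 := by
  have h1 := (h.contDiffAt_pole ha hb).continuousAt.eventually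
    (isOpen_cone.mem_nhds (h.pole_mem a ha b hb hab))
  filter_upwards [h1] with p hp
  exact polar_self (normalize_mem hp)

lemma hasDerivAt_tangentLength_left :
    HasDerivAt (fun u => S.tangentLength c k u b) (S.speed (deriv c a) +
      k * wronskian c a * S.speed (deriv c b) * height c k b a * S.stringFactor c k a b) a := by
  have ht := h.isTangentTriangle ha hb hab
  have e1 := h.height_pos a ha b hb hab.ne'
  have e2 := h.height_pos b hb a ha hab.ne
  have hg := h.sqrt_pos ha hb hab
  have hline : HasDerivAt (fun u : ℝ => (u, b)) (1, 0) a :=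
    (hasDerivAt_id a).prodMk (hasDerivAt_const a b)
  have hap := ((h.contDiffAt_apex ha hb hab).differentiableAt
    (by norm_num)).hasFDerivAt.comp_hasDerivAt a hline
  have hcont : Tendsto (fun u : ℝ => (u, b)) (𝓝 a) (𝓝 (a, b)) := hline.continuousAt.tendsto
  have key := hasDerivAt_add_segmentLength_of_apex (h.curved a ha) ht hap rfl
    (hcont.eventually (h.eventually_apex ha hb hab))
    (Eventually.of_forall fun u => normal_dot_apex_left c k u b)
    (Eventually.of_forall fun u => normal_dot_apex_right c k u b)
  refine key.congr_deriv ?_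
  have hsq := Real.sq_sqrt (h.pole_mem a ha b hb hab).1.le
  rw [stringFactor, abs_neg, abs_of_pos (div_pos e2 hg), abs_of_pos (div_pos e1 hg)]
  set g := √(S.polar (pole c k a b) (pole c k a b))
  rw [← hsq]
  have e3 : k * (normal c a ⬝ᵥ c b) = height c k a b := rfl
  have hn : normal c a ⬝ᵥ c b ≠ 0 := right_ne_zero_of_mul e1.ne'
  rw [← e3]
  field_simp

lemma hasDerivAt_tangentLength_right :
    HasDerivAt (fun u => S.tangentLength c k a u) (-S.speed (deriv c b) -
      k * wronskian c b * S.speed (deriv c a) * height c k a b * S.stringFactor c k a b) b := by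
  have ht := h.isTangentTriangle ha hb hab
  have e1 := h.height_pos a ha b hb hab.ne'
  have e2 := h.height_pos b hb a ha hab.ne
  have hg := h.sqrt_pos ha hb hab
  have hline : HasDerivAt (fun u : ℝ => (a, u)) (0, 1) b :=
    (hasDerivAt_const b a).prodMk (hasDerivAt_id b)
  have hap := ((h.contDiffAt_apex ha hb hab).differentiableAt
    (by norm_num)).hasFDerivAt.comp_hasDerivAt b hline
  have hcont : Tendsto (fun u : ℝ => (a, u)) (𝓝 b) (𝓝 (a, b)) := hline.continuousAt.tendsto
  have key := hasDerivAt_add_segmentLength_of_apex (h.curved b hb) ht.symm hap rfl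
    (hcont.eventually (h.eventually_apex ha hb hab))
    (Eventually.of_forall fun u => normal_dot_apex_right c k a u)
    (Eventually.of_forall fun u => normal_dot_apex_left c k a u)
  have hcomm : (fun u => S.tangentLength c k a u) = fun u =>
      S.segmentLength (c u) (((fun p : ℝ × ℝ => S.apex c k p.1 p.2) ∘ fun u => (a, u)) u) +
      S.segmentLength (c a) (((fun p : ℝ × ℝ => S.apex c k p.1 p.2) ∘ fun u => (a, u)) u) := by
    funext u; rw [tangentLength, add_comm]; rfl
  rw [hcomm]
  refine key.congr_deriv ?_
  have hsq := Real.sq_sqrt (h.pole_mem a ha b hb hab).1.le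
  rw [IsTangentTriangle.angleFactor_symm, stringFactor, abs_neg, abs_of_pos (div_pos e2 hg),
    abs_of_pos (div_pos e1 hg)]
  set g := √(S.polar (pole c k a b) (pole c k a b))
  rw [← hsq]
  have e3 : k * (normal c b ⬝ᵥ c a) = height c k b a := rfl
  have hn : normal c b ⬝ᵥ c a ≠ 0 := right_ne_zero_of_mul e2.ne'
  rw [← e3]
  field_simp
  ring

lemma contDiffAt_tangentLength :
    ContDiffAt ℝ 1 (fun p : ℝ × ℝ => S.tangentLength c k p.1 p.2) (a, b) := by
  have ht := h.isTangentTriangle ha hb hab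
  have hap := h.contDiffAt_apex ha hb hab
  have h1 : ContDiffAt ℝ 1 (fun p : ℝ × ℝ => c p.1) (a, b) :=
    ContDiffAt.comp (a, b) ((h.curved a ha).contDiffAt.of_le (by norm_num)) contDiffAt_fst
  have h2 : ContDiffAt ℝ 1 (fun p : ℝ × ℝ => c p.2) (a, b) :=
    ContDiffAt.comp (a, b) ((h.curved b hb).contDiffAt.of_le (by norm_num)) contDiffAt_snd
  exact (ContDiffAt.comp (a, b) (contDiffAt_segmentLength ht.left_mem ht.apex_mem ht.left_pos
    ht.form_left) (h1.prodMk hap)).add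
    (ContDiffAt.comp (a, b) (contDiffAt_segmentLength ht.right_mem ht.apex_mem ht.symm.left_pos
    ht.symm.form_left) (h2.prodMk hap))

omit ha hb hab in
lemma continuousOn_speed : ContinuousOn (fun u => S.speed (deriv c u)) (Ioo (-δ) δ) := fun u hu =>
  (continuous_speed.continuousAt.comp
    (contDiffAt_deriv (h.curved u hu).contDiffAt).continuousAt).continuousWithinAt

omit hab in
lemma hasStrictFDerivAt_arcLength :
    HasStrictFDerivAt (fun p : ℝ × ℝ => S.arcLength c p.2 p.1)
      ((ContinuousLinearMap.fst ℝ ℝ ℝ).smulRight (S.speed (deriv c a)) -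
        (ContinuousLinearMap.snd ℝ ℝ ℝ).smulRight (S.speed (deriv c b))) (a, b) := by
  have hcont := h.continuousOn_speed
  have hint : IntervalIntegrable (fun u => S.speed (deriv c u)) MeasureTheory.volume b a :=
    (hcont.mono (ordConnected_Ioo.uIcc_subset hb ha)).intervalIntegrable
  have h1 := intervalIntegral.integral_hasStrictFDerivAt hint
    (hcont.stronglyMeasurableAtFilter isOpen_Ioo b hb)
    (hcont.stronglyMeasurableAtFilter isOpen_Ioo a ha)
    (hcont.continuousAt (isOpen_Ioo.mem_nhds hb)) (hcont.continuousAt (isOpen_Ioo.mem_nhds ha))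
  have h2 : HasStrictFDerivAt (fun p : ℝ × ℝ => (p.2, p.1))
      ((ContinuousLinearMap.snd ℝ ℝ ℝ).prod (ContinuousLinearMap.fst ℝ ℝ ℝ)) (a, b) :=
    hasStrictFDerivAt_snd.prodMk hasStrictFDerivAt_fst
  refine (HasStrictFDerivAt.comp (a, b) h1 h2).congr_fderiv ?_
  ext <;> simp

/-- The string length is strictly differentiable, and its partial derivatives are, up to a common
positive factor, the products `D(a) v(b) height(b, a)` and `-D(b) v(a) height(a, b)`. -/
lemma hasStrictFDerivAt_stringL :
    ∃ L' : ℝ × ℝ →L[ℝ] ℝ,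
      HasStrictFDerivAt (fun p : ℝ × ℝ => S.stringL c p.1 p.2 (S.apex c k p.1 p.2)) L' (a, b) ∧
      L' (1, 0) =
        k * wronskian c a * S.speed (deriv c b) * height c k b a * S.stringFactor c k a b ∧
      L' (0, 1) =
        -(k * wronskian c b * S.speed (deriv c a) * height c k a b * S.stringFactor c k a b) := by
  have hH := (h.contDiffAt_tangentLength ha hb hab).hasStrictFDerivAt (by norm_num)
  have hl : HasDerivAt (fun u : ℝ => (u, b)) (1, 0) a :=
    (hasDerivAt_id a).prodMk (hasDerivAt_const a b)
  have hr : HasDerivAt (fun u : ℝ => (a, u)) (0, 1) b :=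
    (hasDerivAt_const b a).prodMk (hasDerivAt_id b)
  have h1 := (HasFDerivAt.comp_hasDerivAt (f := fun u : ℝ => (u, b)) a hH.hasFDerivAt hl).unique
    (h.hasDerivAt_tangentLength_left ha hb hab)
  have h2 := (HasFDerivAt.comp_hasDerivAt (f := fun u : ℝ => (a, u)) b hH.hasFDerivAt hr).unique
    (h.hasDerivAt_tangentLength_right ha hb hab)
  refine ⟨_, hH.sub (h.hasStrictFDerivAt_arcLength ha hb), ?_, ?_⟩
  · rw [_root_.sub_apply, h1]; simp
  · rw [_root_.sub_apply, h2]; simp; ring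

end IsCurvedArc

lemma arcLength_nonneg (hab : b ≤ a) : 0 ≤ S.arcLength c b a :=
  intervalIntegral.integral_nonneg hab fun _ _ => Real.sqrt_nonneg _

lemma tendsto_tangentLength (h : S.IsCurvedAt c k s) :
    Tendsto (fun p : ℝ × ℝ => S.tangentLength c k p.1 p.2) (pairs s) (𝓝 0) := by
  have hap := tendsto_apex h
  have hc := h.contDiffAt.continuousAt
  have hd := (continuousAt_segmentLength_self h.mem).tendsto
  rw [segmentLength_self h.mem] at hd
  have h1 : Tendsto (fun p : ℝ × ℝ => c p.1) (pairs s) (𝓝 (c s)) :=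
    (hc.tendsto.comp (continuous_fst.tendsto (s, s))).mono_left inf_le_left
  have h2 : Tendsto (fun p : ℝ × ℝ => c p.2) (pairs s) (𝓝 (c s)) :=
    (hc.tendsto.comp (continuous_snd.tendsto (s, s))).mono_left inf_le_left
  simpa using! (hd.comp (h1.prodMk_nhds hap)).add (hd.comp (h2.prodMk_nhds hap))

/-- The string length increases with `a` and tends to `0` as `a` decreases to `b`. -/
lemma IsCurvedArc.stringL_pos (h : S.IsCurvedArc c k δ) (ha : a ∈ Ioo (-δ) δ)
    (hb : b ∈ Ioo (-δ) δ) (hab : b < a) : 0 < S.stringL c a b (S.apex c k a b) := by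
  set F : ℝ → ℝ := fun u => S.stringL c u b (S.apex c k u b) with hF
  have hmem : ∀ u ∈ Ioo b δ, u ∈ Ioo (-δ) δ := fun u hu => ⟨hb.1.trans hu.1, hu.2⟩
  have hd : ∀ u ∈ Ioo b δ, ∃ d > 0, HasDerivAt F d u := fun u hu => by
    obtain ⟨L', h1, h2, -⟩ := h.hasStrictFDerivAt_stringL (hmem u hu) hb hu.1
    have hl : HasDerivAt (fun v : ℝ => (v, b)) (1, 0) u :=
      (hasDerivAt_id u).prodMk (hasDerivAt_const u b)
    refine ⟨L' (1, 0), ?_, HasFDerivAt.comp_hasDerivAt (x := u) (f := fun v : ℝ => (v, b))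
      h1.hasFDerivAt hl⟩
    rw [h2]
    have hB := h.curved b hb
    exact mul_pos (mul_pos (mul_pos (h.curved u (hmem u hu)).pos
      (speed_pos hB.mem hB.polar_deriv hB.deriv_ne_zero))
      (h.height_pos b hb u (hmem u hu) hu.1.ne)) (h.stringFactor_pos (hmem u hu) hb hu.1)
  have mono : StrictMonoOn F (Ioo b δ) := by
    refine strictMonoOn_of_deriv_pos (convex_Ioo _ _) (fun u hu => ?_) fun u hu => ?_
    · obtain ⟨d, -, h1⟩ := hd u hu
      exact h1.continuousAt.continuousWithinAt
    · rw [interior_Ioo] at hu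
      obtain ⟨d, h0, h1⟩ := hd u hu
      rwa [h1.deriv]
  have hpair : Tendsto (fun u : ℝ => (u, b)) (𝓝[>] b) (pairs b) := by
    refine tendsto_inf.2 ⟨?_, ?_⟩
    · exact (Continuous.tendsto (by fun_prop) b).mono_left inf_le_left
    · exact tendsto_principal.2 self_mem_nhdsWithin
  have hlim : Tendsto F (𝓝[>] b) (𝓝 0) := by
    have h1 := (tendsto_tangentLength (h.curved b hb)).comp hpair
    have h2 := ((h.hasStrictFDerivAt_arcLength hb hb).hasFDerivAt.continuousAt.tendsto.mono_left
      (inf_le_left : pairs b ≤ _)).comp hpair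
    have e : S.arcLength c b b = 0 := by simp [arcLength]
    simp only [e] at h2
    simpa using! h1.sub h2
  have hmid : (a + b) / 2 ∈ Ioo b δ := ⟨by linarith, by linarith [ha.2, hb.2]⟩
  have h0 : 0 ≤ F ((a + b) / 2) := by
    refine le_of_tendsto hlim ?_
    filter_upwards [Ioo_mem_nhdsGT hmid.1] with u hu
    exact (mono ⟨hu.1, hu.2.trans hmid.2⟩ hmid hu.2).le
  exact h0.trans_lt (mono hmid ⟨hab, ha.2⟩ (by linarith))

end StringLength

/-! ### The symmetric pairing -/

section Symmetry

variable {S : SpaceForm} {c : ℝ → Fin 3 → ℝ} {k s a b δ : ℝ}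

/-- The scaling of the normals `c × c'` which, for a curve with the string Poritsky parameter `t`,
turns them into a linear function of the point of tangency. -/
def weight (S : SpaceForm) (c : ℝ → Fin 3 → ℝ) (t : ℝ → ℝ) (s : ℝ) : ℝ :=
  S.speed (deriv c s) * deriv t s / wronskian c s

/-- On the level sets of the string length `t(a) - t(b)` is constant, so that the differentials of
these two functions are proportional. -/
lemma IsCurvedArc.weight_symm (h : S.IsCurvedArc c k δ) {t : ℝ → ℝ}
    (ht : ∀ s ∈ Ioo (-δ) δ, ContDiffAt ℝ 1 t s)
    (ha : a ∈ Ioo (-δ) δ) (hb : b ∈ Ioo (-δ) δ) (hab : b < a) {q : ℝ}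
    (hq : ∀ a' ∈ Ioo (-δ) δ, ∀ b' ∈ Ioo (-δ) δ, b' < a' →
      S.stringL c a' b' (S.apex c k a' b') = S.stringL c a b (S.apex c k a b) → t a' - t b' = q) :
    S.weight c t a * (normal c a ⬝ᵥ c b) = S.weight c t b * (normal c b ⬝ᵥ c a) := by
  obtain ⟨L', hL, hL1, hL2⟩ := h.hasStrictFDerivAt_stringL ha hb hab
  have hta : HasStrictDerivAt t (deriv t a) a := (ht a ha).hasStrictDerivAt (by norm_num)
  have htb : HasStrictDerivAt t (deriv t b) b := (ht b hb).hasStrictDerivAt (by norm_num)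
  have hφ : HasStrictFDerivAt (fun p : ℝ × ℝ => t p.1 - t p.2)
      (deriv t a • ContinuousLinearMap.fst ℝ ℝ ℝ - deriv t b • ContinuousLinearMap.snd ℝ ℝ ℝ)
      (a, b) :=
    (HasStrictDerivAt.comp_hasStrictFDerivAt (a, b) (h₂ := t) hta hasStrictFDerivAt_fst).sub
      (HasStrictDerivAt.comp_hasStrictFDerivAt (a, b) (h₂ := t) htb hasStrictFDerivAt_snd)
  have hnear : ∀ᶠ p : ℝ × ℝ in 𝓝 (a, b),
      p.1 ∈ Ioo (-δ) δ ∧ p.2 ∈ Ioo (-δ) δ ∧ p.2 < p.1 :=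
    ((continuous_fst.tendsto (a, b)).eventually (isOpen_Ioo.mem_nhds ha)).and
      (((continuous_snd.tendsto (a, b)).eventually (isOpen_Ioo.mem_nhds hb)).and
        ((isOpen_lt continuous_snd continuous_fst).mem_nhds hab))
  have hextr : IsLocalExtrOn (fun p : ℝ × ℝ => t p.1 - t p.2)
      {p | S.stringL c p.1 p.2 (S.apex c k p.1 p.2) =
        S.stringL c (a, b).1 (a, b).2 (S.apex c k (a, b).1 (a, b).2)} (a, b) := by
    left
    filter_upwards [mem_nhdsWithin_of_mem_nhds hnear, self_mem_nhdsWithin] with p hp hp'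
    exact ((hq a ha b hb hab rfl).trans (hq p.1 hp.1 p.2 hp.2.1 hp.2.2 hp').symm).le
  -- Lagrange multipliers; evaluating on the two coordinate vectors eliminates them.
  obtain ⟨x, y, hxy, e⟩ := IsLocalExtrOn.exists_multipliers_of_hasStrictFDerivAt_1d hextr hL hφ
  have e1 := DFunLike.congr_fun e (1, 0)
  have e2 := DFunLike.congr_fun e (0, 1)
  simp [hL1, hL2] at e1 e2
  have hT := h.stringFactor_pos ha hb hab
  have hDa := (h.curved a ha).pos
  have hDb := (h.curved b hb).pos
  have hna := h.height_pos a ha b hb hab.ne'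
  have hnb := h.height_pos b hb a ha hab.ne
  have hva := speed_pos (h.curved a ha).mem (h.curved a ha).polar_deriv
    (h.curved a ha).deriv_ne_zero
  have hvb := speed_pos (h.curved b hb).mem (h.curved b hb).polar_deriv
    (h.curved b hb).deriv_ne_zero
  have hk : k ≠ 0 := left_ne_zero_of_mul hDa.ne'
  have hDa' : wronskian c a ≠ 0 := right_ne_zero_of_mul hDa.ne'
  have hDb' : wronskian c b ≠ 0 := right_ne_zero_of_mul hDb.ne'
  set A := k * wronskian c a * S.speed (deriv c b) * height c k b a * S.stringFactor c k a b with hA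
  set B := k * wronskian c b * S.speed (deriv c a) * height c k a b * S.stringFactor c k a b with hB
  have hA0 : A ≠ 0 := by rw [hA]; positivity
  have hy : y ≠ 0 := by
    rintro rfl
    apply hxy
    have : x = 0 := by simpa [hA0] using e1
    rw [this]; rfl
  have key : A * deriv t b = B * deriv t a := by
    have : y * (A * deriv t b - B * deriv t a) = 0 := by
      linear_combination (-B) * e1 - A * e2
    rcases mul_eq_zero.1 this with h0 | h0
    · exact absurd h0 hy
    · linarith
  have key2 : k ^ 2 * S.stringFactor c k a b * (wronskian c a * S.speed (deriv c b) *
      (normal c b ⬝ᵥ c a) * deriv t b) = k ^ 2 * S.stringFactor c k a b *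
      (wronskian c b * S.speed (deriv c a) * (normal c a ⬝ᵥ c b) * deriv t a) := by
    rw [hA, hB, height, height] at key
    linear_combination key
  have key3 := mul_left_cancel₀ (mul_ne_zero (pow_ne_zero 2 hk) hT.ne') key2
  rw [weight, weight]
  field_simp
  linear_combination -key3

/-- The string length of all pairs of points on a short arc lies in the range `(0, p₀)` covered by the
string Poritsky property, and their apex lies in the prescribed neighborhood. -/
lemma HasStringPoritskyProperty.exists_weight_symm (hc : S.IsCurvedAt c k 0)
    (hP : S.HasStringPoritskyProperty c) :
    ∃ t : ℝ → ℝ, deriv t 0 ≠ 0 ∧ ∀ᶠ δ in 𝓝[>] (0 : ℝ), S.IsCurvedArc c k δ ∧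
      ∀ a ∈ Ioo (-δ) δ, ∀ b ∈ Ioo (-δ) δ,
        S.weight c t a * (normal c a ⬝ᵥ c b) = S.weight c t b * (normal c b ⬝ᵥ c a) := by
  obtain ⟨t, ht, ht0, ε, hε, U, hU, p₀, hp₀, H⟩ := hP
  refine ⟨t, ht0, ?_⟩
  have h1 : ∀ᶠ p : ℝ × ℝ in 𝓝 (0, 0), ContDiffAt ℝ 1 t p.1 :=
    (continuous_fst.tendsto ((0 : ℝ), (0 : ℝ))).eventually (ht.eventually (by simp))
  have h2 : ∀ᶠ p : ℝ × ℝ in 𝓝 (0, 0), p.2 < p.1 → S.apex c k p.1 p.2 ∈ U :=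
    eventually_inf_principal.1 ((tendsto_apex hc).eventually hU)
  have h3 : ∀ᶠ p : ℝ × ℝ in 𝓝 (0, 0), p.2 < p.1 → S.tangentLength c k p.1 p.2 < p₀ :=
    eventually_inf_principal.1 ((tendsto_tangentLength hc).eventually (gt_mem_nhds hp₀))
  filter_upwards [eventually_isCurvedArc hc, eventually_Ioo_prod h1, eventually_Ioo_prod h2,
    eventually_Ioo_prod h3, Ioo_mem_nhdsGT hε] with δ harc H1 H2 H3 hδ
  have hsub : Ioo (-δ) δ ⊆ Ioo (-ε) ε := Ioo_subset_Ioo (by linarith [hδ.2]) hδ.2.le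
  have main : ∀ a ∈ Ioo (-δ) δ, ∀ b ∈ Ioo (-δ) δ, b < a →
      S.weight c t a * (normal c a ⬝ᵥ c b) = S.weight c t b * (normal c b ⬝ᵥ c a) := by
    intro a ha b hb hab
    have hlt : S.stringL c a b (S.apex c k a b) < p₀ := by
      rw [stringL_apex]
      linarith [H3 a ha b hb hab, arcLength_nonneg (S := S) (c := c) hab.le]
    obtain ⟨q, -, hq⟩ := H _ (harc.stringL_pos ha hb hab) hlt
    refine harc.weight_symm (fun s hs => H1 s hs s hs) ha hb hab (q := q) ?_
    intro a' ha' b' hb' hab' he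
    obtain ⟨m1, m2⟩ := harc.apex_mem_tangentGeodesic ha' hb' hab'
    exact hq a' (hsub ha') b' (hsub hb') hab' _ (H2 a' ha' b' hb' hab') m1 m2 he
  refine ⟨harc, fun a ha b hb => ?_⟩
  rcases lt_trichotomy a b with hab | rfl | hab
  · exact (main b hb a ha hab).symm
  · rfl
  · exact main a ha b hb hab

end Symmetry

/-! ### The conic -/

section Conic

variable {S : SpaceForm} {c : ℝ → Fin 3 → ℝ} {k δ : ℝ}

/-- If a pairing `(a, b) ↦ ⟨n a, c b⟩` is symmetric and the vectors `c b` span the space, then `n` is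
a symmetric linear function of `c`. -/
lemma exists_isSymm_mulVec_eq {ι : Type*} {c n : ι → Fin 3 → ℝ}
    (hspan : Submodule.span ℝ (range c) = ⊤) (h : ∀ a b, n a ⬝ᵥ c b = n b ⬝ᵥ c a) :
    ∃ M : Matrix (Fin 3) (Fin 3) ℝ, M.IsSymm ∧ ∀ a, M *ᵥ c a = n a := by
  have hzero : ∀ u : Fin 3 → ℝ, (∀ b, u ⬝ᵥ c b = 0) → u = 0 := by
    intro u hu
    have : ∀ z ∈ Submodule.span ℝ (range c), u ⬝ᵥ z = 0 := by
      intro z hz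
      induction hz using Submodule.span_induction with
      | mem x hx => obtain ⟨b, rfl⟩ := hx; exact hu b
      | zero => simp
      | add x y _ _ hx hy => rw [dotProduct_add, hx, hy, add_zero]
      | smul r x _ hx => rw [dotProduct_smul, hx, smul_zero]
    exact dotProduct_self_eq_zero.1 (this u (hspan ▸ Submodule.mem_top))
  have hrep : ∀ z : Fin 3 → ℝ, ∃ m : Fin 3 → ℝ, ∀ a, n a ⬝ᵥ z = m ⬝ᵥ c a := by
    intro z
    have hz : z ∈ Submodule.span ℝ (range c) := hspan ▸ Submodule.mem_top
    induction hz using Submodule.span_induction with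
    | mem x hx => obtain ⟨b, rfl⟩ := hx; exact ⟨n b, fun a => h a b⟩
    | zero => exact ⟨0, fun a => by simp⟩
    | add x y _ _ hx hy =>
      obtain ⟨m, hm⟩ := hx
      obtain ⟨m', hm'⟩ := hy
      exact ⟨m + m', fun a => by rw [dotProduct_add, add_dotProduct, hm, hm']⟩
    | smul r x _ hx =>
      obtain ⟨m, hm⟩ := hx
      exact ⟨r • m, fun a => by rw [dotProduct_smul, smul_dotProduct, hm]⟩
  choose m hm using hrep
  set M : Matrix (Fin 3) (Fin 3) ℝ := Matrix.of fun i => m (Pi.single i 1) with hM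
  have hMc : ∀ a, M *ᵥ c a = n a := by
    intro a
    ext i
    have := hm (Pi.single i 1) a
    rw [dotProduct_single, mul_one] at this
    exact this.symm
  refine ⟨M, ?_, hMc⟩
  have h1 : ∀ a, (Mᵀ - M) *ᵥ c a = 0 := by
    intro a
    apply hzero
    intro b
    rw [sub_mulVec, sub_dotProduct, mulVec_transpose, ← dotProduct_mulVec, hMc, hMc, h a b,
      dotProduct_comm, sub_self]
  have h2 : Mᵀ - M = 0 := by
    funext i
    apply hzero
    intro b
    exact congrFun (h1 b) i
  exact sub_eq_zero.1 h2

/-- A curve with a non-zero Wronskian does not lie in a plane through the origin. -/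
lemma span_range_eq_top (h : S.IsCurvedAt c k 0) (hδ : 0 < δ) :
    Submodule.span ℝ (range fun s : Ioo (-δ) δ => c s) = ⊤ := by
  by_contra hne
  obtain ⟨f, hf0, hf⟩ := Submodule.exists_le_ker_of_lt_top _ (lt_top_iff_ne_top.2 hne)
  have hI : Ioo (-δ) δ ∈ 𝓝 (0 : ℝ) := Ioo_mem_nhds (by linarith) hδ
  set F := LinearMap.toContinuousLinearMap f with hF
  have h0 : ∀ᶠ s in 𝓝 (0 : ℝ), f (c s) = 0 := by
    filter_upwards [hI] with s hs
    exact hf (Submodule.subset_span ⟨⟨s, hs⟩, rfl⟩)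
  have h1 : ∀ᶠ s in 𝓝 (0 : ℝ), f (deriv c s) = 0 := by
    filter_upwards [h0.eventually_nhds, h.eventually] with s hs hc
    exact (F.hasFDerivAt.comp_hasDerivAt s (hasDerivAt_curve hc.contDiffAt)).unique
      ((hasDerivAt_const s (0 : ℝ)).congr_of_eventuallyEq hs)
  have h2 : f (deriv (deriv c) 0) = 0 :=
    (F.hasFDerivAt.comp_hasDerivAt 0 (hasDerivAt_velocity h.contDiffAt)).unique
      ((hasDerivAt_const 0 (0 : ℝ)).congr_of_eventuallyEq h1)
  -- A linear form that vanishes on the curve vanishes on `c`, `c'` and `c''` at `0`.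
  have hD : c 0 ⬝ᵥ deriv c 0 ⨯₃ deriv (deriv c) 0 ≠ 0 := by
    have := right_ne_zero_of_mul h.pos.ne'
    rwa [wronskian, normal, dotProduct_comm, triple_product_permutation] at this
  apply hf0
  refine LinearMap.ext fun z => ?_
  have e := congrArg f (triple_smul_eq (c 0) (deriv c 0) (deriv (deriv c) 0) z)
  rw [map_add, map_add, map_smul, map_smul, map_smul, map_smul, h0.self_of_nhds,
    h1.self_of_nhds, h2] at e
  simpa [hD] using e

/-- The vector that represents the linear form `polar x` for the standard scalar product. -/
def polarVector (S : SpaceForm) (x : Fin 3 → ℝ) : Fin 3 → ℝ :=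
  ![S.curvature * x 0, S.curvature * x 1, x 2]

lemma polarVector_dotProduct (x y : Fin 3 → ℝ) : S.polarVector x ⬝ᵥ y = S.polar x y := by
  simp [polarVector, polar, dotProduct, Fin.sum_univ_three]; ring

/-- Let `M c(0)` be a non-zero multiple of the normal `c × c'` at `0`. Then the surface and the
quadric of `M` meet transversally at `c 0`, and a point of the conic close to `c 0` is determined by
its scalar product with `c' (0)`. -/
lemma eventually_mem_image (h : S.IsCurvedAt c k 0) {M : Matrix (Fin 3) (Fin 3) ℝ} (hM : M.IsSymm)
    {r : ℝ} (hr : r ≠ 0) (hM0 : M *ᵥ c 0 = r • normal c 0) {ε : ℝ} (hε : 0 < ε)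
    (hsub : c '' Ioo (-ε) ε ⊆ S.conic M) :
    ∀ᶠ x in 𝓝 (c 0), x ∈ S.conic M → x ∈ c '' Ioo (-ε) ε := by
  set v := deriv c 0 with hv
  have hvv : v ⬝ᵥ v ≠ 0 := fun h0 => h.deriv_ne_zero (dotProduct_self_eq_zero.1 h0)
  -- The triple product of the gradients of the two equations and of `v`.
  set Δ : (Fin 3 → ℝ) × (Fin 3 → ℝ) → ℝ := fun p =>
    S.polarVector (p.1 + p.2) ⬝ᵥ (M *ᵥ (p.1 + p.2)) ⨯₃ v with hΔ
  have hcont : Continuous Δ := by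
    simp only [hΔ, polarVector, cross_apply, mulVec, dotProduct, Fin.sum_univ_three, Pi.add_apply,
      cons_val_zero, cons_val_one, cons_val]
    fun_prop
  have h0 : Δ (c 0, c 0) ≠ 0 := by
    have e : Δ (c 0, c 0) = -(4 * r * (v ⬝ᵥ v)) := by
      have e1 : c 0 + c 0 = (2 : ℝ) • c 0 := (two_smul ℝ _).symm
      simp only [hΔ]
      rw [polarVector_dotProduct, e1, polar_smul_left, mulVec_smul, hM0, map_smul, map_smul,
        LinearMap.smul_apply, LinearMap.smul_apply, normal, ← hv, cross_cross_left,
        polar_smul_right, polar_smul_right, polar_sub_right, polar_smul_right, polar_smul_right,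
        h.polar_deriv, polar_self h.mem]
      ring
    rw [e]
    exact neg_ne_zero.2 (mul_ne_zero (mul_ne_zero (by norm_num) hr) hvv)
  have hnhds : ∀ᶠ p in 𝓝 (c 0, c 0), Δ p ≠ 0 := hcont.continuousAt.eventually_ne h0
  rw [nhds_prod_eq] at hnhds
  obtain ⟨O, hO, hO'⟩ := eventually_prod_self_iff (r := fun x y => Δ (x, y) ≠ 0).1 hnhds
  have hV : Ioo (-ε) ε ∩ c ⁻¹' O ∈ 𝓝 (0 : ℝ) :=
    inter_mem (Ioo_mem_nhds (by linarith) hε) (h.contDiffAt.continuousAt hO)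
  have hd : HasStrictDerivAt (fun s => v ⬝ᵥ c s) (v ⬝ᵥ v) 0 := by
    have h1 : HasStrictDerivAt c v 0 := h.contDiffAt.hasStrictDerivAt (by norm_num)
    rw [hasStrictDerivAt_pi] at h1
    simp only [dotProduct, Fin.sum_univ_three]
    exact (((h1 0).const_mul _).add ((h1 1).const_mul _)).add ((h1 2).const_mul _)
  have himg : (fun s => v ⬝ᵥ c s) '' (Ioo (-ε) ε ∩ c ⁻¹' O) ∈ 𝓝 (v ⬝ᵥ c 0) := by
    rw [← hd.map_nhds_eq hvv]
    exact image_mem_map hV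
  have hl : ContinuousAt (fun x : Fin 3 → ℝ => v ⬝ᵥ x) (c 0) :=
    continuousAt_dotProduct continuousAt_const continuousAt_id
  filter_upwards [hO, hl himg] with x hxO hx hxC
  obtain ⟨s, ⟨hs, hsO⟩, hsx⟩ := hx
  refine ⟨s, hs, ?_⟩
  have hsC := hsub ⟨s, hs, rfl⟩
  have hxy := hO' x hxO (c s) hsO
  have hz : x - c s = 0 := by
    refine eq_zero_of_dotProduct_eq_zero hxy ?_ ?_ ?_
    · rw [polarVector_dotProduct, polar_add_left, polar_sub_right, polar_sub_right,
        polar_self hxC.1, polar_self hsC.1, S.polar_comm (c s) x]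
      ring
    · have e1 : (M *ᵥ x) ⬝ᵥ x = 0 := hxC.2
      have e2 : (M *ᵥ c s) ⬝ᵥ c s = 0 := hsC.2
      have e3 : (M *ᵥ c s) ⬝ᵥ x = (M *ᵥ x) ⬝ᵥ c s := by
        rw [dotProduct_comm, dotProduct_mulVec, ← mulVec_transpose, hM.eq]
      simp only [mulVec_add, add_dotProduct, dotProduct_sub, e1, e2, e3]
      ring
    · rw [dotProduct_sub, sub_eq_zero]
      exact hsx.symm
  exact (sub_eq_zero.1 hz).symm

end Conic

end SpaceForm

end

theorem theorem1p6 (S : SpaceForm) (c : ℝ → Fin 3 → ℝ)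
    (hc : S.IsC2CurveGerm c)
    (hcurv : S.geodesicCurvature c 0 ≠ 0)
    (hstring : S.HasStringPoritskyProperty c) :
    S.IsConicGerm c := by
  have hD := SpaceForm.wronskian_ne_zero hc.contDiffAt hc.mem_surface hcurv
  have h0 : S.IsCurvedAt c (SpaceForm.wronskian c 0) 0 :=
    ⟨hc.contDiffAt, hc.mem_surface, mul_self_pos.2 hD⟩
  obtain ⟨t, ht, hev⟩ := hstring.exists_weight_symm h0
  obtain ⟨δ, ⟨harc, hsymm⟩, hδ⟩ := (hev.and self_mem_nhdsWithin).exists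
  replace hδ : 0 < δ := hδ
  obtain ⟨M, hM, hMc⟩ := SpaceForm.exists_isSymm_mulVec_eq
    (c := fun s : Ioo (-δ) δ => c s)
    (n := fun s : Ioo (-δ) δ => S.weight c t s • SpaceForm.normal c s)
    (SpaceForm.span_range_eq_top h0 hδ)
    (fun a b => by
      simp only [smul_dotProduct, smul_eq_mul]
      exact hsymm a a.2 b b.2)
  have hw : S.weight c t 0 ≠ 0 :=
    div_ne_zero (mul_ne_zero (SpaceForm.speed_pos h0.mem h0.polar_deriv h0.deriv_ne_zero).ne' ht) hD
  have hz : (0 : ℝ) ∈ Ioo (-δ) δ := ⟨by linarith, hδ⟩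
  have hM0 : M.mulVec (c 0) = S.weight c t 0 • SpaceForm.normal c 0 := hMc ⟨0, hz⟩
  have hn : SpaceForm.normal c 0 ≠ 0 := fun h => hD (by rw [SpaceForm.wronskian, h]; simp)
  refine ⟨M, hM, ?_, ?_⟩
  · rintro rfl
    rw [Matrix.zero_mulVec] at hM0
    exact smul_ne_zero hw hn hM0.symm
  · filter_upwards [Ioo_mem_nhdsGT hδ] with ε hε
    have hsub : c '' Ioo (-ε) ε ⊆ S.conic M := by
      rintro _ ⟨s, hs, rfl⟩
      have hs' : s ∈ Ioo (-δ) δ := ⟨by linarith [hs.1, hε.2], hs.2.trans hε.2⟩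
      refine ⟨(harc.curved s hs').mem, ?_⟩
      have e : M.mulVec (c s) = S.weight c t s • SpaceForm.normal c s := hMc ⟨s, hs'⟩
      rw [mem_ofPred_eq, e, smul_dotProduct, SpaceForm.normal_dot_self, smul_zero]
    filter_upwards [SpaceForm.eventually_mem_image h0 hM hw hM0 hε.1 hsub] with x hx
    exact propext ⟨fun h => hsub h, hx⟩
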